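/- Let $j\in\{1,2\}$ and let $\alpha=(\alpha_n)_{n\in\mathbb Z}$ be a real sequence in $\ell^{1,j}(\mathbb Z)$, i.e. $\sum_{n\in\mathbb Z}|n|^j|\alpha_n|<\infty$. For $\lambda\in\mathbb R$, the Jost solutions $f_\pm(\lambda,\cdot):\mathbb R\to\mathbb C$ are well-defined: each is the unique continuous function that satisfies $-\partial_{xx}f_\pm(\lambda,x)=\lambda^2f_\pm(\lambda,x)$ for $x\in\mathbb R\setminus\mathbb Z$, the jump conditions $\partial_xf_\pm(\lambda,n+)-\partial_xf_\pm(\lambda,n-)=\alpha_nf_\pm(\lambda,n)$ for $n\in\mathbb Z$, and $f_\pm(\lambda,x)\sim e^{\pm i\lambda x}$ as $x\to\pm\infty$. Put $m_\pm(\lambda,x)=e^{\mp i\lambda x}f_\pm(\lambda,x)$. For $x\in\mathbb R$, the function $\lambda\mapsto m_\pm(\lambda,x)-1$ on $\mathbb R$ defines a tempered distribution; let $T^\pm_x=\mathcal F(m_\pm(\cdot,x)-1)$ be its Fourier transform in $\lambda$ as a tempered distribution in $\xi$, with the convention $\mathcal F(f)(\xi)=\int f(\lambda)e^{-2\pi i\lambda\xi}\,d\lambda$.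 For a tempered distribution $T$ on $\mathbb R$ let $\|T\|_{\mathcal M}=|\mu|(\mathbb R)$ be the total variation norm if $T$ is given by a complex Borel measure $\mu$, and $\|T\|_{\mathcal M}=\infty$ otherwise. Then, for each choice of sign, $$\sup_{\pm x\ge0}\|\xi^{j-1}T^\pm_x\|_{\mathcal M}<\infty,\qquad \sup_{\pm x\ge0}\|\xi^{j-1}\partial_xT^\pm_x\|_{\mathcal M}<\infty,\qquad \sup_{\pm x\ge0}\|\xi^{j-1}\partial_\xi T^\pm_x\|_{\mathcal M}<\infty.$$ Furthermore, for every smooth compactly supported function $\tilde\chi:\mathbb R\to\mathbb C$, $$\sup_{\pm x\ge0}\|\xi^{j-1}(\mathcal F(\tilde\chi)*T^\pm_x)\|_{\mathcal M}<\infty,\qquad \sup_{\pm x\ge0}\|\xi^{j-1}\partial_x(\mathcal F(\tilde\chi)*T^\pm_x)\|_{\mathcal M}<\infty,\qquad \sup_{\pm x\ge0}\|\xi^{j-1}\partial_\xi(\mathcal F(\tilde\chi)*T^\pm_x)\|_{\mathcal M}<\infty.$$ Here $\partial_\xi$ is the distributional derivative, and $\partial_x$ is the derivative in the parameter $x$ in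 the sense of tempered distributions: after pairing with any Schwartz function, the left and right derivatives in $x$ exist at every $x$ with $\pm x\ge0$ and are given by tempered distributions, these coincide if $x\notin\mathbb Z$, and the bounds on $\partial_x$ hold for both. -/

import Mathlib

open MeasureTheory Filter Topology SchwartzMap FourierTransform
open scoped ENNReal ContDiff

namespace DeltaArray

/-- Membership in the weighted space `ℓ^{1,s}(ℤ)`: the sequence `|n|^s |v n|` is summable. -/
def MemWeightedL1 (s : ℝ) (v : ℤ → ℝ) : Prop :=
  Summable fun n : ℤ => |(n : ℝ)| ^ s * |v n|

/-- `f` is the Jost solution at spectral parameter `z` for the array of delta interactions of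
strengths `α` placed at the integers. The sign `ε` is `1` for `f₊` and `-1` for `f₋`. -/
structure IsJostSolution (α : ℤ → ℝ) (ε : ℝ) (z : ℂ) (f : ℝ → ℂ) : Prop where
  /-- Continuity across the integers (elsewhere it follows from the next field). -/
  continuous : Continuous f
  differentiableAt : ∀ x : ℝ, x ∉ Set.range ((↑) : ℤ → ℝ) → DifferentiableAt ℝ f x
  /-- `-f'' = z² f` away from the integers. -/
  equation : ∀ x : ℝ, x ∉ Set.range ((↑) : ℤ → ℝ) → HasDerivAt (deriv f) (-(z ^ 2 * f x)) x
  /-- `f'(n+) - f'(n-) = α n * f n` at every integer `n`. -/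
  jump : ∀ n : ℤ, ∃ dl dr : ℂ, Tendsto (deriv f) (𝓝[<] (n : ℝ)) (𝓝 dl) ∧
    Tendsto (deriv f) (𝓝[>] (n : ℝ)) (𝓝 dr) ∧ dr - dl = α n * f n
  /-- `f x ∼ exp (i ε z x)` as `ε x → +∞`. -/
  asymptotic : Asymptotics.IsEquivalent (comap (fun x : ℝ => ε * x) atTop) f
    (fun x : ℝ => Complex.exp (Complex.I * ε * z * x))

/-- The Jost solution `f_ε(z, ·)`. -/
noncomputable def jost (α : ℤ → ℝ) (ε : ℝ) (z : ℂ) : ℝ → ℂ :=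
  Classical.epsilon (IsJostSolution α ε z)

/-- The normalized Jost solution `m_ε(z, x) = exp (-i ε z x) f_ε(z, x)`. -/
noncomputable def mJost (α : ℤ → ℝ) (ε : ℝ) (z : ℂ) (x : ℝ) : ℂ :=
  Complex.exp (-(Complex.I * ε * z * x)) * jost α ε z x

/-- The tempered distribution `U` is the one given by the function `u`. -/
def IsGivenBy (U : 𝓢'(ℝ, ℂ)) (u : ℝ → ℂ) : Prop :=
  ∀ φ : 𝓢(ℝ, ℂ), Integrable (fun t => u t * φ t) ∧ U φ = ∫ t, u t * φ t

/-- The tempered distribution `T` is the one given by the complex Borel measure `μ`. -/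
def IsGivenByMeasure (T : 𝓢'(ℝ, ℂ)) (μ : ComplexMeasure ℝ) : Prop :=
  ∀ φ : 𝓢(ℝ, ℂ), T φ = VectorMeasure.integral μ (fun t => φ t) (ContinuousLinearMap.mul ℝ ℂ)

/-- The total variation norm of a tempered distribution: it is `|μ|(ℝ)` if the distribution is
given by a complex measure `μ`, and `∞` if it is not given by a complex measure. -/
noncomputable def tvNorm (T : 𝓢'(ℝ, ℂ)) : ℝ≥0∞ :=
  ⨅ (μ : ComplexMeasure ℝ) (_ : IsGivenByMeasure T μ), μ.variation Set.univ

/-- The product `ξ^k T`. -/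
noncomputable def mulPow (k : ℕ) (T : 𝓢'(ℝ, ℂ)) : 𝓢'(ℝ, ℂ) :=
  TemperedDistribution.smulLeftCLM ℂ (fun ξ : ℝ => (ξ : ℂ) ^ k) T

/-- The reflection `ξ ↦ g (-ξ)` of a Schwartz function. -/
noncomputable def reflect (g : 𝓢(ℝ, ℂ)) : 𝓢(ℝ, ℂ) :=
  SchwartzMap.compCLMOfContinuousLinearEquiv ℂ (ContinuousLinearEquiv.neg ℝ) g

/-- The convolution `g ∗ T` of a Schwartz function and a tempered distribution, that is,
`⟨g ∗ T, φ⟩ = ⟨T, g(-·) ∗ φ⟩`. -/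
noncomputable def conv (g : 𝓢(ℝ, ℂ)) (T : 𝓢'(ℝ, ℂ)) : 𝓢'(ℝ, ℂ) :=
  PointwiseConvergenceCLM.precomp ℂ
    (SchwartzMap.convolution (ContinuousLinearMap.mul ℂ ℂ) (reflect g)) T

/-- `D` is the derivative at `x`, within `s`, of the family `y ↦ T y` of tempered distributions
(for `s = Set.Iic x` the left derivative, for `s = Set.Ici x` the right derivative). -/
def HasParamDerivWithin (T : ℝ → 𝓢'(ℝ, ℂ)) (D : 𝓢'(ℝ, ℂ)) (s : Set ℝ) (x : ℝ) : Prop :=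
  ∀ φ : 𝓢(ℝ, ℂ), HasDerivWithinAt (fun y => T y φ) (D φ) s x

/-- `sup_{ε x ≥ 0} ‖ξ^k T_x‖ < ∞`. -/
def BoundedTV (ε : ℝ) (k : ℕ) (T : ℝ → 𝓢'(ℝ, ℂ)) : Prop :=
  (⨆ x ∈ {x : ℝ | 0 ≤ ε * x}, tvNorm (mulPow k (T x))) < ⊤

/-- `sup_{ε x ≥ 0} ‖ξ^k ∂_x T_x‖ < ∞`. Both one-sided derivatives in `x` exist at every `x` with
`ε x ≥ 0`, they agree unless `x` is an integer, and both satisfy the bound. -/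
def BoundedTVDerivParam (ε : ℝ) (k : ℕ) (T : ℝ → 𝓢'(ℝ, ℂ)) : Prop :=
  ∃ Dl Dr : ℝ → 𝓢'(ℝ, ℂ),
    (∀ x : ℝ, 0 ≤ ε * x → HasParamDerivWithin T (Dl x) (Set.Iic x) x ∧
      HasParamDerivWithin T (Dr x) (Set.Ici x) x) ∧
    (∀ x : ℝ, 0 ≤ ε * x → x ∉ Set.range ((↑) : ℤ → ℝ) → Dl x = Dr x) ∧
    BoundedTV ε k Dl ∧ BoundedTV ε k Dr

/-- `sup_{ε x ≥ 0} ‖ξ^k ∂_ξ T_x‖ < ∞`, with the distributional derivative in `ξ`. -/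
def BoundedTVDeriv (ε : ℝ) (k : ℕ) (T : ℝ → 𝓢'(ℝ, ℂ)) : Prop :=
  BoundedTV ε k fun x => TemperedDistribution.derivCLM ℂ (T x)

end DeltaArray

/-!
Writing `f₊ = exp (iλx) m₊`, the Born series exhibits `m₊(·, x) - 1` as the inverse Fourier
transform of a measure: a scattering at the site `n > x` contributes the multiplier
`α n * (exp (2iλ(n - x)) - 1) / (2iλ)`, which is the transform of the density `π * α n` on an
interval of length `(n - x) / π`. Convolution with this density multiplies the weighted mass by at
most `|α n| * (n - x) * (1 + (n - x)) ^ p`, so a discrete Gronwall argument bounds the weighted mass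
of the full series by an exponential of the moment `∑ |α n| * (1 + |n|) ^ (p + 1)`, uniformly in
`x ≥ 0`. Differentiating in `x` or in `ξ` replaces the uniform densities by point masses at their
endpoints, so the same bounds apply. Uniqueness of the Jost solution comes from the Wronskian of two
solutions, and `f₋` is obtained from `f₊` by reflecting the array.
-/

open scoped NNReal

namespace DeltaArray

section Density

variable {Ω E F G : Type*} [MeasurableSpace Ω] {P : Measure Ω}
  [NormedAddCommGroup E] [NormedAddCommGroup F] [NormedAddCommGroup G] {h : Ω → F} {f g : Ω → E}

theorem integrable_norm_mul_of_withDensity_enorm (hh : AEStronglyMeasurable h P)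
    (hf : Integrable f (P.withDensity fun x => ‖h x‖ₑ)) :
    Integrable (fun x => ‖h x‖ * ‖f x‖) P := by
  simpa using (integrable_withDensity_iff_integrable_smul₀' hh.enorm (by simp)).1 hf.norm

variable [NormedSpace ℝ E] [NormedSpace ℝ F] [NormedSpace ℝ G]

theorem apply_ae_congr_of_withDensity_enorm (hh : AEStronglyMeasurable h P) (B : E →L[ℝ] F →L[ℝ] G)
    (hfg : f =ᵐ[P.withDensity fun x => ‖h x‖ₑ] g) :
    (fun x => B (f x) (h x)) =ᵐ[P] fun x => B (g x) (h x) := by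
  rw [EventuallyEq, ae_withDensity_iff' hh.enorm] at hfg
  filter_upwards [hfg] with x hx
  by_cases h0 : h x = 0
  · simp only [h0, map_zero]
  · rw [hx (enorm_ne_zero.2 h0)]

theorem integrable_apply_of_withDensity_enorm (hh : AEStronglyMeasurable h P)
    (B : E →L[ℝ] F →L[ℝ] G) (hf : Integrable f (P.withDensity fun x => ‖h x‖ₑ)) :
    Integrable (fun x => B (f x) (h x)) P := by
  have hcongr := hf.1.ae_eq_mk
  refine Integrable.congr ?_ (apply_ae_congr_of_withDensity_enorm hh B hcongr.symm)
  refine ((integrable_norm_mul_of_withDensity_enorm hh (hf.congr hcongr)).const_mul ‖B‖).mono'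
    (B.aestronglyMeasurable_comp₂ hf.1.stronglyMeasurable_mk.aestronglyMeasurable hh)
    (Eventually.of_forall fun x => (B.le_opNorm₂ _ _).trans_eq (by ring))

theorem norm_integral_apply_le_withDensity_enorm (hh : AEStronglyMeasurable h P)
    (B : E →L[ℝ] F →L[ℝ] G) (hf : Integrable f (P.withDensity fun x => ‖h x‖ₑ)) :
    ‖∫ x, B (f x) (h x) ∂P‖ ≤ ‖B‖ * ∫ x, ‖f x‖ ∂(P.withDensity fun x => ‖h x‖ₑ) := by
  rw [integral_withDensity_eq_integral_toReal_smul₀ hh.enorm (by simp), ← integral_const_mul]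
  refine norm_integral_le_of_norm_le ?_ (Eventually.of_forall fun x => ?_)
  · simpa using (integrable_norm_mul_of_withDensity_enorm hh hf).const_mul ‖B‖
  · simpa [mul_comm, mul_assoc, mul_left_comm] using B.le_opNorm₂ (f x) (h x)

theorem integral_withDensityᵥ_indicator [CompleteSpace F] [CompleteSpace G] (hh : Integrable h P)
    (B : E →L[ℝ] F →L[ℝ] G) {s : Set Ω} (hs : MeasurableSet s)
    (hfin : (P.withDensityᵥ h).variation s < ⊤) (c : E) :
    VectorMeasure.integral (P.withDensityᵥ h) (s.indicator fun _ => c) B =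
      ∫ x, B (s.indicator (fun _ => c) x) (h x) ∂P := by
  have hind : (fun x => B (s.indicator (fun _ => c) x) (h x)) = s.indicator fun x => B c (h x) := by
    ext x
    by_cases hx : x ∈ s <;> simp [hx]
  rw [hind, integral_indicator hs, (B c).integral_comp_comm hh.integrableOn,
    VectorMeasure.integral_eq_setToFun, setToFun_indicator_const _ hs hfin.ne,
    transpose_eq_cbmApplyMeasure, cbmApplyMeasure_apply, withDensityᵥ_apply hh hs]

theorem continuous_integral_apply_withDensity_enorm (hh : AEStronglyMeasurable h P)
    (B : E →L[ℝ] F →L[ℝ] G) :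
    Continuous fun f : Ω →₁[P.withDensity fun x => ‖h x‖ₑ] E => ∫ x, B (f x) (h x) ∂P := by
  have hint (f : Ω →₁[P.withDensity fun x => ‖h x‖ₑ] E) :=
    integrable_apply_of_withDensity_enorm hh B (L1.integrable_coeFn f)
  refine (LipschitzWith.of_dist_le_mul (K := ‖B‖₊) fun f g => ?_).continuous
  calc dist (∫ x, B (f x) (h x) ∂P) (∫ x, B (g x) (h x) ∂P)
      = ‖∫ x, B ((f - g : Ω →₁[_] E) x) (h x) ∂P‖ := by
        rw [dist_eq_norm, ← integral_sub (hint f) (hint g), integral_congr_ae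
          (apply_ae_congr_of_withDensity_enorm hh B (Lp.coeFn_sub f g))]
        simp only [Pi.sub_apply, map_sub, sub_apply]
    _ ≤ ‖B‖₊ * dist f g := by
        rw [dist_eq_norm, L1.norm_eq_integral_norm]
        exact norm_integral_apply_le_withDensity_enorm hh B (L1.integrable_coeFn _)

theorem integral_withDensityᵥ [CompleteSpace F] [CompleteSpace G] (hh : Integrable h P)
    (B : E →L[ℝ] F →L[ℝ] G) (hf : Integrable f (P.withDensity fun x => ‖h x‖ₑ)) :
    VectorMeasure.integral (P.withDensityᵥ h) f B = ∫ x, B (f x) (h x) ∂P := by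
  have hvar : (P.withDensityᵥ h).variation = P.withDensity fun x => ‖h x‖ₑ :=
    Measure.variation_withDensityᵥ hh
  refine Integrable.induction (fun f : Ω → E =>
    VectorMeasure.integral (P.withDensityᵥ h) f B = ∫ x, B (f x) (h x) ∂P)
    (fun c s hs hfin => integral_withDensityᵥ_indicator hh B hs (hvar ▸ hfin) c)
    (fun f g _ hf hg hfe hge => ?_) ?_ (fun f g hfg _ hfe => ?_) hf
  · rw [VectorMeasure.integral_add (by rwa [VectorMeasure.Integrable, hvar])
      (by rwa [VectorMeasure.Integrable, hvar]), hfe, hge,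
      ← integral_add (integrable_apply_of_withDensity_enorm hh.1 B hf)
        (integrable_apply_of_withDensity_enorm hh.1 B hg)]
    simp only [Pi.add_apply, map_add, add_apply]
  · rw [← hvar]
    refine isClosed_eq VectorMeasure.continuous_integral ?_
    rw [hvar]
    exact continuous_integral_apply_withDensity_enorm hh.1 B
  · rw [← VectorMeasure.integral_congr_ae (hvar ▸ hfg), hfe,
      integral_congr_ae (apply_ae_congr_of_withDensity_enorm hh.1 B hfg)]

end Density

theorem tvNorm_le_of_eq_integral {Ω : Type*} [MeasurableSpace Ω] {P : Measure Ω} {h : Ω → ℂ}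
    {X : Ω → ℝ} (hX : Measurable X) (hh : Integrable h P) {T : 𝓢'(ℝ, ℂ)}
    (hT : ∀ φ : 𝓢(ℝ, ℂ), T φ = ∫ o, h o * φ (X o) ∂P) : tvNorm T ≤ ∫⁻ o, ‖h o‖ₑ ∂P := by
  have hvar : (P.withDensityᵥ h).variation = P.withDensity fun x => ‖h x‖ₑ :=
    Measure.variation_withDensityᵥ hh
  have : IsFiniteMeasure (P.withDensity fun x => ‖h x‖ₑ) := isFiniteMeasure_withDensity hh.2.ne
  have hint (φ : 𝓢(ℝ, ℂ)) : Integrable (fun o => φ (X o)) (P.withDensity fun x => ‖h x‖ₑ) :=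
    .of_bound (φ.continuous.measurable.comp hX).aestronglyMeasurable
      (SchwartzMap.seminorm ℝ 0 0 φ) (Eventually.of_forall fun o => norm_le_seminorm ℝ φ _)
  have hgiven : IsGivenByMeasure T ((P.withDensityᵥ h).map X) := by
    intro φ
    rw [VectorMeasure.integral_map hX φ.continuous.aestronglyMeasurable
      (by rw [VectorMeasure.Integrable, hvar]; exact hint φ), integral_withDensityᵥ hh _ (hint φ),
      hT]
    simp only [ContinuousLinearMap.mul_apply', mul_comm]
  calc tvNorm T ≤ ((P.withDensityᵥ h).map X).variation Set.univ := iInf₂_le _ hgiven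
    _ ≤ (P.withDensityᵥ h).variation.map X Set.univ := VectorMeasure.variation_map_le _
    _ = ∫⁻ o, ‖h o‖ₑ ∂P := by
        rw [Measure.map_apply hX MeasurableSet.univ, hvar, Set.preimage_univ,
          withDensity_apply _ MeasurableSet.univ, Measure.restrict_univ]

/-- A positive measure `P` on `ℝ × ℂ` encodes the complex measure `φ ↦ ∫ w * φ s ∂P(s, w)` on `ℝ`.
With this encoding, sums and convolutions of complex measures become sums and push-forwards of
positive measures. -/
noncomputable def pairing (P : Measure (ℝ × ℂ)) (φ : ℝ → ℂ) : ℂ := ∫ q, q.2 * φ q.1 ∂P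

/-- The mass `∫ |w| (1 + |s|)^p ∂P(s, w)`, which bounds the total variation of the complex measure
encoded by `P`, taken with the weight `(1 + |ξ|)^p`. -/
noncomputable def mass (p : ℕ) (P : Measure (ℝ × ℂ)) : ℝ≥0∞ :=
  ∫⁻ q, ‖q.2‖ₑ * (1 + ‖q.1‖ₑ) ^ p ∂P

/-- Encodes the convolution of the complex measure `g • Q` with the one encoded by `P`. -/
noncomputable def convDensity (Q : Measure ℝ) (g : ℝ → ℂ) (P : Measure (ℝ × ℂ)) :
    Measure (ℝ × ℂ) :=
  (Q.prod P).map fun z => (z.1 + z.2.1, g z.1 * z.2.2)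

section Pairing

variable {P P' : Measure (ℝ × ℂ)} {φ : ℝ → ℂ} {C : ℝ}

theorem lintegral_enorm_snd_le_mass (p : ℕ) (P : Measure (ℝ × ℂ)) : ∫⁻ q, ‖q.2‖ₑ ∂P ≤ mass p P :=
  lintegral_mono fun _ => le_mul_of_one_le_right' (one_le_pow₀ (by simp))

theorem integrable_snd_of_mass_ne_top {p : ℕ} (h : mass p P ≠ ⊤) : Integrable Prod.snd P :=
  ⟨measurable_snd.aestronglyMeasurable, (lintegral_enorm_snd_le_mass p P).trans_lt h.lt_top⟩

theorem integrable_snd_mul (h : Integrable Prod.snd P) (hφ : Measurable φ) (hC : ∀ s, ‖φ s‖ ≤ C) :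
    Integrable (fun q : ℝ × ℂ => q.2 * φ q.1) P :=
  h.mul_bdd (c := C) (hφ.comp measurable_fst).aestronglyMeasurable
    (Eventually.of_forall fun _ => hC _)

theorem norm_pairing_le_integral (h : Integrable Prod.snd P) (hC : ∀ s, ‖φ s‖ ≤ C) :
    ‖pairing P φ‖ ≤ C * ∫ q, ‖q.2‖ ∂P := by
  rw [← integral_const_mul]
  refine norm_integral_le_of_norm_le (h.norm.const_mul C) (Eventually.of_forall fun q => ?_)
  rw [norm_mul, mul_comm]
  gcongr
  exact hC _

theorem norm_pairing_le {p : ℕ} {M : ℝ} (hM : 0 ≤ M) (h : mass p P ≤ ENNReal.ofReal M)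
    (hC : ∀ s, ‖φ s‖ ≤ C) : ‖pairing P φ‖ ≤ C * M := by
  have hint : Integrable Prod.snd P :=
    integrable_snd_of_mass_ne_top (ne_top_of_le_ne_top ENNReal.ofReal_ne_top h)
  refine (norm_pairing_le_integral hint hC).trans ?_
  have hC0 : 0 ≤ C := (norm_nonneg _).trans (hC 0)
  gcongr
  rw [integral_norm_eq_lintegral_enorm measurable_snd.aestronglyMeasurable]
  exact ENNReal.toReal_le_of_le_ofReal hM ((lintegral_enorm_snd_le_mass p P).trans h)

theorem mass_add (p : ℕ) (P P' : Measure (ℝ × ℂ)) : mass p (P + P') = mass p P + mass p P' :=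
  lintegral_add_measure _ _ _

theorem mass_sum (p : ℕ) {ι : Type*} (P : ι → Measure (ℝ × ℂ)) :
    mass p (Measure.sum P) = ∑' i, mass p (P i) :=
  lintegral_sum_measure _ _

theorem pairing_add (h : Integrable Prod.snd P) (h' : Integrable Prod.snd P') (hφ : Measurable φ)
    (hC : ∀ s, ‖φ s‖ ≤ C) : pairing (P + P') φ = pairing P φ + pairing P' φ :=
  integral_add_measure (integrable_snd_mul h hφ hC) (integrable_snd_mul h' hφ hC)

theorem hasSum_pairing {ι : Type*} [Countable ι] {P : ι → Measure (ℝ × ℂ)}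
    (h : Integrable Prod.snd (Measure.sum P)) (hφ : Measurable φ) (hC : ∀ s, ‖φ s‖ ≤ C) :
    HasSum (fun i => pairing (P i) φ) (pairing (Measure.sum P) φ) :=
  hasSum_integral_measure (integrable_snd_mul h hφ hC)

theorem mass_dirac_zero_one (p : ℕ) : mass p (Measure.dirac ((0 : ℝ), (1 : ℂ))) = 1 := by
  simp [mass]

theorem pairing_dirac_zero_one (φ : ℝ → ℂ) :
    pairing (Measure.dirac ((0 : ℝ), (1 : ℂ))) φ = φ 0 := by
  simp [pairing]

end Pairing

section ConvDensity

variable {Q : Measure ℝ} {g : ℝ → ℂ} {P : Measure (ℝ × ℂ)} {φ : ℝ → ℂ} {C : ℝ}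

instance [SFinite Q] [SFinite P] : SFinite (convDensity Q g P) := by
  unfold convDensity; infer_instance

theorem measurable_convDensity_map (hg : Measurable g) :
    Measurable fun z : ℝ × (ℝ × ℂ) => (z.1 + z.2.1, g z.1 * z.2.2) := by
  fun_prop

theorem convDensity_sum {ι : Type*} [Countable ι] (Q : Measure ℝ) [SFinite Q] (hg : Measurable g)
    (P : ι → Measure (ℝ × ℂ)) [∀ i, SFinite (P i)] :
    convDensity Q g (Measure.sum P) = Measure.sum fun i => convDensity Q g (P i) := by
  unfold convDensity
  rw [Measure.prod_sum_right, Measure.map_sum (measurable_convDensity_map hg).aemeasurable]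

theorem one_add_enorm_add_le (r s : ℝ) : 1 + ‖r + s‖ₑ ≤ (1 + ‖r‖ₑ) * (1 + ‖s‖ₑ) :=
  calc 1 + ‖r + s‖ₑ ≤ 1 + (‖r‖ₑ + ‖s‖ₑ) := by gcongr; exact enorm_add_le _ _
    _ ≤ 1 + (‖r‖ₑ + ‖s‖ₑ) + ‖r‖ₑ * ‖s‖ₑ := le_self_add
    _ = (1 + ‖r‖ₑ) * (1 + ‖s‖ₑ) := by ring

theorem mass_convDensity_le (p : ℕ) (hg : Measurable g) (P : Measure (ℝ × ℂ)) [SFinite P] :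
    mass p (convDensity Q g P) ≤ (∫⁻ r, ‖g r‖ₑ * (1 + ‖r‖ₑ) ^ p ∂Q) * mass p P := by
  unfold convDensity mass
  rw [lintegral_map (by fun_prop) (measurable_convDensity_map hg),
    ← lintegral_prod_mul (by fun_prop) (by fun_prop)]
  refine lintegral_mono fun z => ?_
  calc ‖g z.1 * z.2.2‖ₑ * (1 + ‖z.1 + z.2.1‖ₑ) ^ p
      ≤ ‖g z.1‖ₑ * ‖z.2.2‖ₑ * ((1 + ‖z.1‖ₑ) * (1 + ‖z.2.1‖ₑ)) ^ p := by
        rw [enorm_mul]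
        gcongr
        exact one_add_enorm_add_le _ _
    _ = ‖g z.1‖ₑ * (1 + ‖z.1‖ₑ) ^ p * (‖z.2.2‖ₑ * (1 + ‖z.2.1‖ₑ) ^ p) := by
        rw [mul_pow]; ring

theorem integrable_convDensity_integrand (hg : Integrable g Q) (h : Integrable Prod.snd P)
    (hφ : Measurable φ) (hC : ∀ s, ‖φ s‖ ≤ C) :
    Integrable (fun z : ℝ × (ℝ × ℂ) => g z.1 * z.2.2 * φ (z.1 + z.2.1)) (Q.prod P) :=
  (hg.mul_prod h).mul_bdd (c := C) (Measurable.aestronglyMeasurable (by fun_prop))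
    (Eventually.of_forall fun _ => hC _)

variable [SFinite Q] [SFinite P]

theorem pairing_convDensity (hgm : Measurable g) (hg : Integrable g Q) (h : Integrable Prod.snd P)
    (hφ : Measurable φ) (hC : ∀ s, ‖φ s‖ ≤ C) :
    pairing (convDensity Q g P) φ = ∫ r, g r * pairing P (fun s => φ (r + s)) ∂Q := by
  unfold pairing convDensity
  rw [integral_map (measurable_convDensity_map hgm).aemeasurable
      (Measurable.aestronglyMeasurable (by fun_prop)),
    integral_prod _ (integrable_convDensity_integrand hg h hφ hC)]
  simp_rw [mul_assoc, integral_const_mul]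

theorem pairing_convDensity_swap (hgm : Measurable g) (hg : Integrable g Q)
    (h : Integrable Prod.snd P) (hφ : Measurable φ) (hC : ∀ s, ‖φ s‖ ≤ C) :
    pairing (convDensity Q g P) φ = pairing P fun s => ∫ r, g r * φ (r + s) ∂Q := by
  unfold pairing convDensity
  rw [integral_map (measurable_convDensity_map hgm).aemeasurable
      (Measurable.aestronglyMeasurable (by fun_prop)),
    integral_prod_symm _ (integrable_convDensity_integrand hg h hφ hC)]
  simp_rw [mul_comm (g _) (Prod.snd _), mul_assoc, integral_const_mul]

end ConvDensity

section Distribution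

theorem norm_schwartz_le (φ : 𝓢(ℝ, ℂ)) (s : ℝ) : ‖φ s‖ ≤ SchwartzMap.seminorm ℂ 0 0 φ :=
  norm_le_seminorm ℂ φ s

theorem integrable_snd_mul_schwartz {P : Measure (ℝ × ℂ)} (h : Integrable Prod.snd P)
    (φ : 𝓢(ℝ, ℂ)) : Integrable (fun q : ℝ × ℂ => q.2 * φ q.1) P :=
  integrable_snd_mul h φ.continuous.measurable (norm_schwartz_le φ)

/-- The tempered distribution given by the complex measure encoded by `P`. -/
noncomputable def toDistribution (P : Measure (ℝ × ℂ)) (h : Integrable Prod.snd P) : 𝓢'(ℝ, ℂ) :=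
  (SchwartzMap.mkCLMtoNormedSpace (fun φ : 𝓢(ℝ, ℂ) => pairing P φ)
    (fun φ ψ => by
      simp only [pairing, add_apply, mul_add]
      exact integral_add (integrable_snd_mul_schwartz h φ) (integrable_snd_mul_schwartz h ψ))
    (fun c φ => by
      simp only [pairing, smul_apply, smul_eq_mul, mul_left_comm _ c,
        integral_const_mul, RingHom.id_apply])
    ⟨{(0, 0)}, ∫ q, ‖q.2‖ ∂P, integral_nonneg fun _ => norm_nonneg _, fun φ => by
      rw [Finset.sup_singleton, mul_comm]
      exact norm_pairing_le_integral h (norm_schwartz_le φ)⟩ :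
    𝓢(ℝ, ℂ) →L[ℂ] ℂ).toPointwiseConvergenceCLM _ _ _ _

@[simp]
theorem toDistribution_apply {P : Measure (ℝ × ℂ)} (h : Integrable Prod.snd P) (φ : 𝓢(ℝ, ℂ)) :
    toDistribution P h φ = pairing P φ :=
  rfl

/-- The tempered distribution `T` is given by a complex measure whose total variation with the
weight `(1 + |ξ|)^p` is at most `C`. -/
def HasRep (p : ℕ) (C : ℝ≥0) (T : 𝓢'(ℝ, ℂ)) : Prop :=
  ∃ P : Measure (ℝ × ℂ), SFinite P ∧ mass p P ≤ C ∧ ∀ φ : 𝓢(ℝ, ℂ), T φ = pairing P φ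

variable {p : ℕ} {C C' : ℝ≥0} {T T' : 𝓢'(ℝ, ℂ)}

theorem HasRep.add (h : HasRep p C T) (h' : HasRep p C' T') : HasRep p (C + C') (T + T') := by
  obtain ⟨P, _, hm, hT⟩ := h
  obtain ⟨P', _, hm', hT'⟩ := h'
  refine ⟨P + P', inferInstance, ?_, fun φ => ?_⟩
  · rw [mass_add, ENNReal.coe_add]
    exact add_le_add hm hm'
  · rw [pairing_add (integrable_snd_of_mass_ne_top (ne_top_of_le_ne_top ENNReal.coe_ne_top hm))
      (integrable_snd_of_mass_ne_top (ne_top_of_le_ne_top ENNReal.coe_ne_top hm'))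
      φ.continuous.measurable (norm_schwartz_le φ), ← hT, ← hT']
    rfl

theorem HasRep.tvNorm_mulPow_le (h : HasRep p C T) : tvNorm (mulPow p T) ≤ C := by
  obtain ⟨P, _, hm, hT⟩ := h
  have hle : ∫⁻ q : ℝ × ℂ, ‖q.2 * (q.1 : ℂ) ^ p‖ₑ ∂P ≤ C := by
    refine le_trans (lintegral_mono fun q => ?_) hm
    rw [enorm_mul, enorm_pow, ← ofReal_norm (q.1 : ℂ), Complex.norm_real, ofReal_norm]
    gcongr
    exact le_add_self
  refine (tvNorm_le_of_eq_integral (h := fun q : ℝ × ℂ => q.2 * (q.1 : ℂ) ^ p) measurable_fst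
    ⟨Measurable.aestronglyMeasurable (by fun_prop), hle.trans_lt ENNReal.coe_lt_top⟩
    fun φ => ?_).trans hle
  rw [mulPow, TemperedDistribution.smulLeftCLM_apply_apply, hT]
  refine integral_congr_ae (Eventually.of_forall fun q => ?_)
  simp only [SchwartzMap.smulLeftCLM_apply_apply (g := fun ξ : ℝ => (ξ : ℂ) ^ p) (by fun_prop),
    smul_eq_mul, mul_assoc]

theorem convolution_reflect_apply (g φ : 𝓢(ℝ, ℂ)) (s : ℝ) :
    SchwartzMap.convolution (ContinuousLinearMap.mul ℂ ℂ) (reflect g) φ s =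
      ∫ r, g r * φ (r + s) := by
  rw [SchwartzMap.convolution_apply, MeasureTheory.convolution,
    ← integral_neg_eq_self (fun r => g r * φ (r + s))]
  refine integral_congr_ae (Eventually.of_forall fun r => ?_)
  simp [reflect, sub_eq_neg_add]

theorem conv_apply (g : 𝓢(ℝ, ℂ)) (T : 𝓢'(ℝ, ℂ)) (φ : 𝓢(ℝ, ℂ)) :
    conv g T φ = T (SchwartzMap.convolution (ContinuousLinearMap.mul ℂ ℂ) (reflect g) φ) :=
  rfl

theorem lintegral_schwartz_mul_one_add_pow_lt_top (p : ℕ) (g : 𝓢(ℝ, ℂ)) :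
    ∫⁻ r, ‖g r‖ₑ * (1 + ‖r‖ₑ) ^ p < ⊤ := by
  have hint : Integrable fun r : ℝ => 2 ^ (p - 1) * (‖g r‖ + ‖r‖ ^ p * ‖g r‖) :=
    (g.integrable.norm.add (g.integrable_pow_mul volume p)).const_mul _
  refine lt_of_le_of_lt (lintegral_mono fun r => ?_) hint.lintegral_lt_top
  calc ‖g r‖ₑ * (1 + ‖r‖ₑ) ^ p = ENNReal.ofReal (‖g r‖ * (1 + ‖r‖) ^ p) := by
        rw [ENNReal.ofReal_mul (norm_nonneg _), ENNReal.ofReal_pow (by positivity),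
          ENNReal.ofReal_add zero_le_one (norm_nonneg _), ofReal_norm, ofReal_norm,
          ENNReal.ofReal_one]
    _ ≤ ENNReal.ofReal (‖g r‖ * (2 ^ (p - 1) * (1 ^ p + ‖r‖ ^ p))) := by
        gcongr
        exact add_pow_le zero_le_one (norm_nonneg r) p
    _ = ENNReal.ofReal (2 ^ (p - 1) * (‖g r‖ + ‖r‖ ^ p * ‖g r‖)) := by
        congr 1; rw [one_pow]; ring

/-- The `L¹` norm of a Schwartz function with the weight `(1 + |ξ|)^p`. -/
noncomputable def weightedNorm (p : ℕ) (g : 𝓢(ℝ, ℂ)) : ℝ≥0 :=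
  (∫⁻ r, ‖g r‖ₑ * (1 + ‖r‖ₑ) ^ p).toNNReal

theorem HasRep.conv (h : HasRep p C T) (g : 𝓢(ℝ, ℂ)) :
    HasRep p (weightedNorm p g * C) (conv g T) := by
  obtain ⟨P, _, hm, hT⟩ := h
  refine ⟨convDensity volume g P, inferInstance, ?_, fun φ => ?_⟩
  · rw [ENNReal.coe_mul, weightedNorm,
      ENNReal.coe_toNNReal (lintegral_schwartz_mul_one_add_pow_lt_top p g).ne]
    exact (mass_convDensity_le p g.continuous.measurable P).trans (by gcongr)
  · rw [pairing_convDensity_swap g.continuous.measurable g.integrable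
      (integrable_snd_of_mass_ne_top (ne_top_of_le_ne_top ENNReal.coe_ne_top hm))
      φ.continuous.measurable (norm_schwartz_le φ), conv_apply, hT]
    simp_rw [← convolution_reflect_apply]

theorem integral_mul_deriv_schwartz_translate (g φ : 𝓢(ℝ, ℂ)) (s : ℝ) :
    ∫ r, g r * deriv φ (r + s) = -∫ r, deriv g r * φ (r + s) := by
  have hint (f u : 𝓢(ℝ, ℂ)) : Integrable fun r => f r * u (r + s) :=
    f.integrable.mul_bdd (c := SchwartzMap.seminorm ℂ 0 0 u)
      (Continuous.aestronglyMeasurable (by fun_prop))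
      (Eventually.of_forall fun r => norm_schwartz_le u _)
  exact integral_mul_deriv_eq_deriv_mul_of_integrable (u := g) (v := fun r => φ (r + s))
    (fun r _ => g.hasDerivAt r) (fun r _ => (φ.hasDerivAt (r + s)).comp_add_const r s)
    (hint g (SchwartzMap.derivCLM ℂ ℂ φ)) (hint (SchwartzMap.derivCLM ℂ ℂ g) φ) (hint g φ)

theorem derivCLM_conv (g : 𝓢(ℝ, ℂ)) (T : 𝓢'(ℝ, ℂ)) :
    TemperedDistribution.derivCLM ℂ (conv g T) = conv (SchwartzMap.derivCLM ℂ ℂ g) T := by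
  ext φ
  rw [TemperedDistribution.derivCLM_apply_apply, conv_apply, conv_apply]
  congr 1
  ext s
  simp only [map_neg, _root_.neg_apply, convolution_reflect_apply,
    SchwartzMap.derivCLM_apply, integral_mul_deriv_schwartz_translate, neg_neg]

end Distribution

section Gronwall

variable {c : ℤ → ℝ}

theorem add_tsum_indicator_Ioi_le (h0 : ∀ n, 0 ≤ c n) (hc : Summable c) {a b : ℤ} (hab : a < b) :
    c b + ∑' m, (Set.Ioi b).indicator c m ≤ ∑' m, (Set.Ioi a).indicator c m := by
  have hb : c b = ∑' m, ({b} : Set ℤ).indicator c m := by rw [← tsum_subtype, tsum_singleton]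
  rw [hb, ← (hc.indicator _).tsum_add (hc.indicator _)]
  refine ((hc.indicator _).add (hc.indicator _)).tsum_le_tsum (fun m => ?_) (hc.indicator _)
  rcases lt_trichotomy m b with hm | rfl | hm
  · simpa [hm.ne, hm.le] using Set.indicator_nonneg (fun n _ => h0 n) m
  · simp [hab]
  · simp [hm, hm.ne', hab.trans hm]

-- A discrete Gronwall inequality: each term is at most the increment `exp (c n + t) - exp t`
-- of the exponentials of the tail sums.
theorem sum_mul_exp_tail_le (h0 : ∀ n, 0 ≤ c n) (hc : Summable c) (s : Finset ℤ) {a : ℤ}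
    (ha : ∀ n ∈ s, a < n) :
    ∑ n ∈ s, c n * Real.exp (∑' m, (Set.Ioi n).indicator c m) ≤
      Real.exp (∑' m, (Set.Ioi a).indicator c m) - 1 := by
  induction s using Finset.induction_on_min generalizing a with
  | empty =>
    have : 0 ≤ ∑' m, (Set.Ioi a).indicator c m :=
      tsum_nonneg fun m => Set.indicator_nonneg (fun n _ => h0 n) m
    simpa using Real.one_le_exp this
  | insert b s hb ih =>
    rw [Finset.sum_insert fun hmem => lt_irrefl _ (hb b hmem)]
    have hstep : c b * Real.exp (∑' m, (Set.Ioi b).indicator c m) +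
        Real.exp (∑' m, (Set.Ioi b).indicator c m) ≤
          Real.exp (∑' m, (Set.Ioi a).indicator c m) :=
      calc _ = (c b + 1) * Real.exp (∑' m, (Set.Ioi b).indicator c m) := by ring
        _ ≤ Real.exp (c b) * Real.exp (∑' m, (Set.Ioi b).indicator c m) := by
          gcongr
          exact Real.add_one_le_exp _
        _ ≤ _ := by
          rw [← Real.exp_add]
          exact Real.exp_le_exp.2
            (add_tsum_indicator_Ioi_le h0 hc (ha b (Finset.mem_insert_self _ _)))
    linarith [ih hb]

end Gronwall

section Majorant

/-- `∑ₙ |α n| (1 + |n|)^k < ∞`. -/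
def WeightSummable (α : ℤ → ℝ) (k : ℕ) : Prop :=
  Summable fun n : ℤ => |α n| * (1 + |(n : ℝ)|) ^ k

/-- The coefficients `|α n| (n - x)₊ (1 + (n - x)₊)^p`, which bound the weighted mass gained by
scattering at the site `n`. -/
noncomputable def coef (α : ℤ → ℝ) (p : ℕ) (x : ℝ) (n : ℤ) : ℝ :=
  |α n| * (max (n - x) 0 * (1 + max (n - x) 0) ^ p)

/-- The majorant `exp (∑ₙ |α n| (n - x)₊ (1 + (n - x)₊)^p)` of the weighted mass of the Fourier
transform of `m₊(·, x)`. -/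
noncomputable def majorant (α : ℤ → ℝ) (p : ℕ) (x : ℝ) : ℝ :=
  Real.exp (∑' n, coef α p x n)

variable {α : ℤ → ℝ} {p k : ℕ}

theorem WeightSummable.mono (h : WeightSummable α p) (hkp : k ≤ p) : WeightSummable α k :=
  h.of_nonneg_of_le (fun _ => by positivity) fun n => by
    gcongr
    linarith [abs_nonneg (n : ℝ)]

theorem coef_nonneg (α : ℤ → ℝ) (p : ℕ) (x : ℝ) (n : ℤ) : 0 ≤ coef α p x n := by
  unfold coef; positivity

theorem coef_anti (α : ℤ → ℝ) (p : ℕ) (n : ℤ) : Antitone fun x => coef α p x n := by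
  intro x y hxy
  simp only [coef]
  have : 0 ≤ max ((n : ℝ) - y) 0 := le_max_right _ _
  gcongr

theorem coef_of_le {x : ℝ} {n : ℤ} (h : (n : ℝ) ≤ x) : coef α p x n = 0 := by
  simp [coef, max_eq_right (sub_nonpos.2 h)]

theorem summable_coef (h : WeightSummable α (p + 1)) (x : ℝ) : Summable (coef α p x) := by
  refine Summable.of_nonneg_of_le (coef_nonneg α p x) (fun n => ?_)
    (h.mul_left ((1 + |x|) ^ (p + 1)))
  have hle : 1 + max ((n : ℝ) - x) 0 ≤ (1 + |x|) * (1 + |(n : ℝ)|) := by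
    have : max ((n : ℝ) - x) 0 ≤ |(n : ℝ)| + |x| :=
      max_le (by linarith [le_abs_self (n : ℝ), neg_abs_le x]) (by positivity)
    nlinarith [mul_nonneg (abs_nonneg x) (abs_nonneg (n : ℝ))]
  calc coef α p x n ≤ |α n| * ((1 + max ((n : ℝ) - x) 0) * (1 + max ((n : ℝ) - x) 0) ^ p) := by
        unfold coef; gcongr; linarith
    _ = |α n| * (1 + max ((n : ℝ) - x) 0) ^ (p + 1) := by rw [pow_succ']
    _ ≤ |α n| * ((1 + |x|) * (1 + |(n : ℝ)|)) ^ (p + 1) := by gcongr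
    _ = (1 + |x|) ^ (p + 1) * (|α n| * (1 + |(n : ℝ)|) ^ (p + 1)) := by rw [mul_pow]; ring

theorem one_le_majorant (α : ℤ → ℝ) (p : ℕ) (x : ℝ) : 1 ≤ majorant α p x :=
  Real.one_le_exp (tsum_nonneg (coef_nonneg α p x))

theorem majorant_nonneg (α : ℤ → ℝ) (p : ℕ) (x : ℝ) : 0 ≤ majorant α p x := (Real.exp_pos _).le

theorem majorant_anti (h : WeightSummable α (p + 1)) : Antitone (majorant α p) := fun x y hxy =>
  Real.exp_le_exp.2 ((summable_coef h y).tsum_le_tsum (fun n => coef_anti α p n hxy)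
    (summable_coef h x))

theorem tendsto_majorant (h : WeightSummable α (p + 1)) :
    Tendsto (majorant α p) atTop (𝓝 1) := by
  have htsum : Tendsto (fun x => ∑' n, coef α p x n) atTop (𝓝 (∑' _ : ℤ, (0 : ℝ))) := by
    refine tendsto_tsum_of_dominated_convergence (summable_coef h 0) (fun n => ?_) ?_
    · refine tendsto_const_nhds.congr' ?_
      filter_upwards [eventually_ge_atTop (n : ℝ)] with x hx
      rw [coef_of_le hx]
    · filter_upwards [eventually_ge_atTop 0] with x hx n
      rw [Real.norm_of_nonneg (coef_nonneg _ _ _ _)]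
      exact coef_anti α p n hx
  rw [tsum_zero] at htsum
  rw [← Real.exp_zero]
  exact (Real.continuous_exp.tendsto 0).comp htsum

theorem one_add_sum_coef_mul_majorant_le (h : WeightSummable α (p + 1)) (x : ℝ) (s : Finset ℤ) :
    1 + ∑ n ∈ s, coef α p x n * majorant α p n ≤ majorant α p x := by
  have hc := summable_coef h x
  obtain ⟨b, hb⟩ := s.bddBelow
  have hgronwall := sum_mul_exp_tail_le (coef_nonneg α p x) hc s (a := b - 1)
    fun n hn => Int.sub_one_lt_of_le (hb hn)
  have htail : Real.exp (∑' m, (Set.Ioi (b - 1)).indicator (coef α p x) m) ≤ majorant α p x :=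
    Real.exp_le_exp.2 ((hc.indicator _).tsum_le_tsum
      (fun m => Set.indicator_le_self' (fun _ _ => coef_nonneg _ _ _ _) m) hc)
  have hterm : ∑ n ∈ s, coef α p x n * majorant α p n ≤
      ∑ n ∈ s, coef α p x n * Real.exp (∑' m, (Set.Ioi n).indicator (coef α p x) m) := by
    refine Finset.sum_le_sum fun n _ => ?_
    rcases le_or_gt (n : ℝ) x with hn | hn
    · simp [coef_of_le hn]
    · refine mul_le_mul_of_nonneg_left (Real.exp_le_exp.2 ?_) (coef_nonneg _ _ _ _)
      refine (summable_coef h n).tsum_le_tsum (fun m => ?_) (hc.indicator _)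
      rcases le_or_gt m n with hm | hm
      · rw [coef_of_le (by exact_mod_cast hm)]
        exact Set.indicator_nonneg (fun _ _ => coef_nonneg _ _ _ _) m
      · rw [Set.indicator_of_mem (Set.mem_Ioi.2 hm)]
        exact coef_anti α p m hn.le
  linarith

theorem one_add_tsum_coef_mul_majorant_le (h : WeightSummable α (p + 1)) (x : ℝ) :
    1 + ∑' n, ENNReal.ofReal (coef α p x n) * ENNReal.ofReal (majorant α p n) ≤
      ENNReal.ofReal (majorant α p x) := by
  have hterm (n : ℤ) : 0 ≤ coef α p x n * majorant α p n :=
    mul_nonneg (coef_nonneg _ _ _ _) (majorant_nonneg _ _ _)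
  simp_rw [← ENNReal.ofReal_mul (coef_nonneg α p x _)]
  rw [ENNReal.tsum_eq_iSup_sum, ENNReal.add_iSup]
  refine iSup_le fun s => ?_
  rw [← ENNReal.ofReal_sum_of_nonneg fun n _ => hterm n, ← ENNReal.ofReal_one,
    ← ENNReal.ofReal_add zero_le_one (Finset.sum_nonneg fun n _ => hterm n)]
  exact ENNReal.ofReal_le_ofReal (one_add_sum_coef_mul_majorant_le h x s)

end Majorant

section BornSeries

/-- One scattering event at the site `n`, on the Fourier side: convolution with the density
`π α n` on `(0, (n - x) / π]`. -/
noncomputable def scatter (α : ℤ → ℝ) (x : ℝ) (n : ℤ) (P : Measure (ℝ × ℂ)) : Measure (ℝ × ℂ) :=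
  convDensity (volume.restrict (Set.Ioc 0 ((n - x) / Real.pi))) (fun _ => ↑(Real.pi * α n)) P

/-- The terms of the Born series of the normalized Jost solution, on the Fourier side. -/
noncomputable def bornTerm (α : ℤ → ℝ) : ℕ → ℝ → Measure (ℝ × ℂ)
  | 0, _ => Measure.dirac (0, 1)
  | i + 1, x => Measure.sum fun n : ℤ => scatter α x n (bornTerm α i n)

/-- Encodes the Fourier transform of `m₊(·, x)`. -/
noncomputable def jostMeasure (α : ℤ → ℝ) (x : ℝ) : Measure (ℝ × ℂ) :=
  Measure.sum fun i => bornTerm α i x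

/-- Encodes the Fourier transform of `m₊(·, x) - 1`. -/
noncomputable def scatteringMeasure (α : ℤ → ℝ) (x : ℝ) : Measure (ℝ × ℂ) :=
  Measure.sum fun i => bornTerm α (i + 1) x

instance (α : ℤ → ℝ) (x : ℝ) (n : ℤ) (P : Measure (ℝ × ℂ)) [SFinite P] :
    SFinite (scatter α x n P) := by
  unfold scatter; infer_instance

instance sFinite_bornTerm (α : ℤ → ℝ) (i : ℕ) (x : ℝ) : SFinite (bornTerm α i x) := by
  induction i generalizing x with
  | zero => unfold bornTerm; infer_instance
  | succ i ih => unfold bornTerm; infer_instance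

instance (α : ℤ → ℝ) (x : ℝ) : SFinite (jostMeasure α x) := by
  unfold jostMeasure; infer_instance

instance (α : ℤ → ℝ) (x : ℝ) : SFinite (scatteringMeasure α x) := by
  unfold scatteringMeasure; infer_instance

variable {α : ℤ → ℝ} {p : ℕ} {φ : ℝ → ℂ} {C : ℝ}

theorem setLIntegral_Ioc_one_add_enorm_pow_le (p : ℕ) (y : ℝ) :
    ∫⁻ r in Set.Ioc 0 (y / Real.pi), (1 + ‖r‖ₑ) ^ p ≤
      ENNReal.ofReal (max y 0 / Real.pi * (1 + max y 0) ^ p) := by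
  have hpi := Real.pi_pos
  have hr : ∀ r ∈ Set.Ioc 0 (y / Real.pi), (1 + ‖r‖ₑ) ^ p ≤
      ENNReal.ofReal ((1 + max y 0) ^ p) := by
    intro r hr
    have hy : 0 < y := (div_pos_iff_of_pos_right hpi).1 (hr.1.trans_le hr.2)
    have hry : ‖r‖ ≤ max y 0 := by
      rw [Real.norm_of_nonneg hr.1.le]
      exact le_max_of_le_left (hr.2.trans (div_le_self hy.le (by linarith [Real.pi_gt_three])))
    rw [ENNReal.ofReal_pow (by positivity), ENNReal.ofReal_add zero_le_one (by positivity),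
      ENNReal.ofReal_one, ← ofReal_norm]
    gcongr
  calc ∫⁻ r in Set.Ioc 0 (y / Real.pi), (1 + ‖r‖ₑ) ^ p
      ≤ ∫⁻ _ in Set.Ioc 0 (y / Real.pi), ENNReal.ofReal ((1 + max y 0) ^ p) :=
        setLIntegral_mono measurable_const hr
    _ = ENNReal.ofReal (y / Real.pi) * ENNReal.ofReal ((1 + max y 0) ^ p) := by
        rw [setLIntegral_const, Real.volume_Ioc, sub_zero, mul_comm]
    _ ≤ ENNReal.ofReal (max y 0 / Real.pi) * ENNReal.ofReal ((1 + max y 0) ^ p) := by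
        gcongr
        exact le_max_left _ _
    _ = ENNReal.ofReal (max y 0 / Real.pi * (1 + max y 0) ^ p) :=
        (ENNReal.ofReal_mul (by positivity)).symm

theorem mass_scatter_le (α : ℤ → ℝ) (p : ℕ) (x : ℝ) (n : ℤ) (P : Measure (ℝ × ℂ)) [SFinite P] :
    mass p (scatter α x n P) ≤ ENNReal.ofReal (coef α p x n) * mass p P := by
  have hpi := Real.pi_pos
  refine (mass_convDensity_le p measurable_const P).trans ?_
  gcongr
  rw [lintegral_const_mul _ (by fun_prop), ← ofReal_norm, Complex.norm_real, norm_mul,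
    Real.norm_of_nonneg hpi.le, Real.norm_eq_abs]
  calc ENNReal.ofReal (Real.pi * |α n|) * ∫⁻ r in Set.Ioc 0 ((n - x) / Real.pi), (1 + ‖r‖ₑ) ^ p
      ≤ ENNReal.ofReal (Real.pi * |α n|) *
          ENNReal.ofReal (max (n - x) 0 / Real.pi * (1 + max (n - x) 0) ^ p) := by
        gcongr
        exact setLIntegral_Ioc_one_add_enorm_pow_le p _
    _ = ENNReal.ofReal (coef α p x n) := by
        rw [← ENNReal.ofReal_mul (by positivity), coef]
        congr 1
        field_simp

theorem sum_mass_bornTerm_le (h : WeightSummable α (p + 1)) (k : ℕ) (x : ℝ) :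
    ∑ i ∈ Finset.range k, mass p (bornTerm α i x) ≤ ENNReal.ofReal (majorant α p x) := by
  induction k generalizing x with
  | zero => simp
  | succ k ih =>
    refine le_trans ?_ (one_add_tsum_coef_mul_majorant_le h x)
    rw [Finset.sum_range_succ', add_comm]
    refine add_le_add (mass_dirac_zero_one p).le ?_
    calc ∑ i ∈ Finset.range k, mass p (bornTerm α (i + 1) x)
        ≤ ∑ i ∈ Finset.range k, ∑' n : ℤ,
            ENNReal.ofReal (coef α p x n) * mass p (bornTerm α i n) := by
          refine Finset.sum_le_sum fun i _ => ?_
          rw [bornTerm, mass_sum]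
          exact ENNReal.tsum_le_tsum fun n => mass_scatter_le α p x n _
      _ = ∑' n : ℤ, ENNReal.ofReal (coef α p x n) *
            ∑ i ∈ Finset.range k, mass p (bornTerm α i n) := by
          rw [← Summable.tsum_finsetSum fun i _ => ENNReal.summable]
          simp_rw [Finset.mul_sum]
      _ ≤ _ := ENNReal.tsum_le_tsum fun n => by gcongr; exact ih n

theorem mass_jostMeasure_le (h : WeightSummable α (p + 1)) (x : ℝ) :
    mass p (jostMeasure α x) ≤ ENNReal.ofReal (majorant α p x) := by
  rw [jostMeasure, mass_sum, ENNReal.tsum_eq_iSup_nat]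
  exact iSup_le fun k => sum_mass_bornTerm_le h k x

theorem mass_jostMeasure_eq (α : ℤ → ℝ) (p : ℕ) (x : ℝ) :
    mass p (jostMeasure α x) = 1 + mass p (scatteringMeasure α x) := by
  rw [jostMeasure, scatteringMeasure, mass_sum, mass_sum,
    tsum_eq_zero_add' (f := fun i => mass p (bornTerm α i x)) ENNReal.summable, bornTerm,
    mass_dirac_zero_one]

theorem mass_scatteringMeasure_le (h : WeightSummable α (p + 1)) (x : ℝ) :
    mass p (scatteringMeasure α x) ≤ ENNReal.ofReal (majorant α p x - 1) := by
  rw [ENNReal.ofReal_sub _ zero_le_one, ENNReal.ofReal_one]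
  refine ENNReal.le_sub_of_add_le_left ENNReal.one_ne_top ?_
  exact (mass_jostMeasure_eq α p x).symm.trans_le (mass_jostMeasure_le h x)

theorem integrable_snd_jostMeasure (h : WeightSummable α 1) (x : ℝ) :
    Integrable Prod.snd (jostMeasure α x) :=
  integrable_snd_of_mass_ne_top
    (ne_top_of_le_ne_top ENNReal.ofReal_ne_top (mass_jostMeasure_le (p := 0) h x))

theorem integrable_snd_scatteringMeasure (h : WeightSummable α 1) (x : ℝ) :
    Integrable Prod.snd (scatteringMeasure α x) :=
  integrable_snd_of_mass_ne_top
    (ne_top_of_le_ne_top ENNReal.ofReal_ne_top (mass_scatteringMeasure_le (p := 0) h x))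

theorem norm_pairing_jostMeasure_le (h : WeightSummable α 1) (x : ℝ) (hC : ∀ s, ‖φ s‖ ≤ C) :
    ‖pairing (jostMeasure α x) φ‖ ≤ C * majorant α 0 x :=
  norm_pairing_le (majorant_nonneg _ _ _) (mass_jostMeasure_le h x) hC

theorem pairing_jostMeasure (h : WeightSummable α 1) (x : ℝ) (hφ : Measurable φ)
    (hC : ∀ s, ‖φ s‖ ≤ C) :
    pairing (jostMeasure α x) φ = φ 0 + pairing (scatteringMeasure α x) φ := by
  have hjost := hasSum_pairing (integrable_snd_jostMeasure h x) hφ hC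
  have hscat := hasSum_pairing (integrable_snd_scatteringMeasure h x) hφ hC
  rw [jostMeasure, scatteringMeasure, ← hjost.tsum_eq, ← hscat.tsum_eq,
    hjost.summable.tsum_eq_zero_add, bornTerm, pairing_dirac_zero_one]

theorem scatteringMeasure_eq_sum_scatter (α : ℤ → ℝ) (x : ℝ) :
    scatteringMeasure α x = Measure.sum fun n : ℤ => scatter α x n (jostMeasure α n) := by
  unfold scatteringMeasure jostMeasure scatter
  simp_rw [convDensity_sum _ measurable_const, bornTerm]
  exact Measure.sum_comm _

theorem hasSum_pairing_scatteringMeasure (h : WeightSummable α 1) (x : ℝ) (hφ : Measurable φ)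
    (hC : ∀ s, ‖φ s‖ ≤ C) :
    HasSum (fun n : ℤ => ((Real.pi * α n : ℝ) : ℂ) * ∫ r in Set.Ioc 0 ((n - x) / Real.pi),
      pairing (jostMeasure α n) fun s => φ (r + s)) (pairing (scatteringMeasure α x) φ) := by
  have hint := integrable_snd_scatteringMeasure h x
  rw [scatteringMeasure_eq_sum_scatter] at hint ⊢
  convert hasSum_pairing hint hφ hC using 2 with n
  rw [scatter, pairing_convDensity measurable_const (integrable_const _)
    (integrable_snd_jostMeasure h n) hφ hC, integral_const_mul]

end BornSeries

section Calculus

variable {E : Type*} [NormedAddCommGroup E] [NormedSpace ℝ E]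

theorem norm_deriv_le_of_norm_le_of_norm_deriv2_le {F F' F'' : ℝ → E} {a B M : ℝ}
    (hF : ∀ t ∈ Set.Ioo a (a + 1), HasDerivAt F (F' t) t)
    (hF' : ∀ t ∈ Set.Ioo a (a + 1), HasDerivAt F' (F'' t) t)
    (hB : ∀ t ∈ Set.Ioo a (a + 1), ‖F t‖ ≤ B) (hM : ∀ t ∈ Set.Ioo a (a + 1), ‖F'' t‖ ≤ M)
    {x : ℝ} (hx : x ∈ Set.Ioo a (a + 1)) : ‖F' x‖ ≤ 8 * B + M := by
  have hM0 : 0 ≤ M := (norm_nonneg _).trans (hM x hx)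
  obtain ⟨y, hy, hxy⟩ : ∃ y ∈ Set.Ioo a (a + 1), 1 / 4 ≤ |y - x| := by
    rcases le_or_gt x (a + 1 / 2) with h | h
    · exact ⟨a + 3 / 4, ⟨by linarith, by linarith⟩, le_abs.2 (Or.inl (by linarith))⟩
    · exact ⟨a + 1 / 4, ⟨by linarith, by linarith⟩, le_abs.2 (Or.inr (by linarith))⟩
  have hF'x : ∀ t ∈ Set.Ioo a (a + 1), ‖F' t - F' x‖ ≤ M := by
    intro t ht
    refine ((convex_Ioo a (a + 1)).norm_image_sub_le_of_norm_hasDerivWithin_le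
      (fun s hs => (hF' s hs).hasDerivWithinAt) hM hx ht).trans
        (mul_le_of_le_one_right hM0 ?_)
    rw [Real.norm_eq_abs, abs_le]
    constructor <;> linarith [hx.1, hx.2, ht.1, ht.2]
  have htaylor : ‖F y - F x - (y - x) • F' x‖ ≤ M * |y - x| := by
    have := (convex_Ioo a (a + 1)).norm_image_sub_le_of_norm_hasDerivWithin_le
      (f := fun t => F t - t • F' x) (f' := fun t => F' t - F' x)
      (fun t ht => by
        simpa using ((hF t ht).fun_sub ((hasDerivAt_id' t).smul_const (F' x))).hasDerivWithinAt)
      hF'x hx hy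
    rwa [Real.norm_eq_abs, sub_sub_sub_comm, ← sub_smul] at this
  have hdiff : |y - x| * ‖F' x‖ ≤ 2 * B + M * |y - x| :=
    calc |y - x| * ‖F' x‖ = ‖(F y - F x) - (F y - F x - (y - x) • F' x)‖ := by
          rw [sub_sub_cancel, norm_smul, Real.norm_eq_abs]
      _ ≤ ‖F y‖ + ‖F x‖ + ‖F y - F x - (y - x) • F' x‖ :=
          (norm_sub_le _ _).trans (by gcongr; exact norm_sub_le _ _)
      _ ≤ 2 * B + M * |y - x| := by linarith [hB x hx, hB y hy]
  by_contra! hlt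
  nlinarith [norm_nonneg (F x), hB x hx]

theorem exists_eq_const_of_hasDerivAt_zero_off_countable [CompleteSpace E] {w : ℝ → E} {S : Set ℝ}
    (hS : S.Countable) (hSc : IsClosed S) (hw : ∀ x ∉ S, HasDerivAt w 0 x)
    (hlim : ∀ x ∈ S, ∃ y, Tendsto w (𝓝[≠] x) (𝓝 y)) : ∃ c, ∀ x ∉ S, w x = c := by
  have hext : ∀ x, ∃ y, Tendsto w (𝓝[Sᶜ] x) (𝓝 y) := by
    intro x
    by_cases hx : x ∈ S
    · obtain ⟨y, hy⟩ := hlim x hx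
      exact ⟨y, hy.mono_left (nhdsWithin_mono _ fun t ht htx => ht (htx ▸ hx))⟩
    · exact ⟨w x, (hw x hx).continuousAt.tendsto.mono_left nhdsWithin_le_nhds⟩
  have hdense : Dense Sᶜ := hS.dense_compl ℝ
  have heq : ∀ x ∉ S, extendFrom Sᶜ w x = w x := fun x hx =>
    extendFrom_eq (hdense x) ((hw x hx).continuousAt.tendsto.mono_left nhdsWithin_le_nhds)
  have hcont : Continuous (extendFrom Sᶜ w) := continuous_extendFrom hdense hext
  have hderiv : ∀ x ∉ S, HasDerivAt (extendFrom Sᶜ w) 0 x := fun x hx =>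
    (hw x hx).congr_of_eventuallyEq (by
      filter_upwards [hSc.isOpen_compl.mem_nhds hx] with t ht using heq t ht)
  have hconst : ∀ a b, a ≤ b → extendFrom Sᶜ w a = extendFrom Sᶜ w b := by
    intro a b hab
    have := integral_eq_of_hasDerivAt_off_countable_of_le _ (fun _ => 0) hab hS
      hcont.continuousOn (fun x hx => hderiv x hx.2) (by simp)
    rw [intervalIntegral.integral_zero] at this
    exact (sub_eq_zero.1 this.symm).symm
  refine ⟨extendFrom Sᶜ w 0, fun x hx => ?_⟩
  rw [← heq x hx]
  rcases le_total 0 x with h | h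
  · exact (hconst _ _ h).symm
  · exact hconst _ _ h

theorem hasDerivAt_exp_const_mul (c : ℂ) (x : ℝ) :
    HasDerivAt (fun y : ℝ => Complex.exp (c * y)) (c * Complex.exp (c * x)) x := by
  have := ((Complex.ofRealCLM.hasDerivAt (x := x)).const_mul c).cexp
  simpa [mul_comm] using this

theorem eq_zero_of_hasDerivAt_const_mul {w : ℝ → ℂ} {a b : ℝ} {c : ℂ}
    (hw : ∀ x ∈ Set.Ioo a b, HasDerivAt w (c * w x) x) (hlim : Tendsto w (𝓝[<] b) (𝓝 0)) :
    ∀ x ∈ Set.Ioo a b, w x = 0 := by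
  intro x hx
  let u : ℝ → ℂ := fun y => w y * Complex.exp (-c * y)
  have hderiv : ∀ y ∈ Set.Ioo a b, HasDerivAt u 0 y := fun y hy =>
    ((hw y hy).mul (hasDerivAt_exp_const_mul (-c) y)).congr_deriv (by ring)
  have hconst : ∀ y ∈ Set.Ioo a b, u y = u x := fun y hy =>
    (isOpen_Ioo (a := a) (b := b)).is_const_of_deriv_eq_zero isPreconnected_Ioo
      (fun t ht => (hderiv t ht).differentiableAt.differentiableWithinAt)
      (fun t ht => (hderiv t ht).deriv) hy hx
  have hulim : Tendsto u (𝓝[<] b) (𝓝 0) := by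
    simpa only [zero_mul] using
      hlim.mul ((hasDerivAt_exp_const_mul (-c) b).continuousAt.tendsto.mono_left nhdsWithin_le_nhds)
  have hux : u x = 0 := by
    refine tendsto_nhds_unique (tendsto_const_nhds.congr' ?_) hulim
    filter_upwards [Ioo_mem_nhdsLT (hx.1.trans hx.2)] with y hy
    exact (hconst y hy).symm
  exact (mul_eq_zero.1 hux).resolve_right (Complex.exp_ne_zero _)

end Calculus

section Solution

/-- `f` solves the equation of the delta array at spectral parameter `z`, with no condition at
infinity, and `f'` is its derivative off the integers. -/
structure IsSolution (α : ℤ → ℝ) (z : ℂ) (f f' : ℝ → ℂ) : Prop where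
  continuous : Continuous f
  hasDerivAt : ∀ x : ℝ, x ∉ Set.range ((↑) : ℤ → ℝ) → HasDerivAt f (f' x) x
  equation : ∀ x : ℝ, x ∉ Set.range ((↑) : ℤ → ℝ) → HasDerivAt f' (-(z ^ 2 * f x)) x
  jump : ∀ n : ℤ, ∃ dl dr : ℂ, Tendsto f' (𝓝[<] (n : ℝ)) (𝓝 dl) ∧
    Tendsto f' (𝓝[>] (n : ℝ)) (𝓝 dr) ∧ dr - dl = α n * f n

variable {α : ℤ → ℝ} {ε : ℝ} {z : ℂ} {f f' g g' : ℝ → ℂ}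

theorem notMem_range_intCast_of_mem_Ioo {n : ℤ} {x : ℝ} (hx : x ∈ Set.Ioo (n : ℝ) (n + 1)) :
    x ∉ Set.range ((↑) : ℤ → ℝ) := by
  rintro ⟨m, rfl⟩
  have hnm : n < m := by exact_mod_cast hx.1
  have hmn : m < n + 1 := by exact_mod_cast hx.2
  omega

theorem IsJostSolution.isSolution (h : IsJostSolution α ε z f) : IsSolution α z f (deriv f) :=
  ⟨h.continuous, fun x hx => (h.differentiableAt x hx).hasDerivAt, h.equation, h.jump⟩

theorem IsSolution.sub (hf : IsSolution α z f f') (hg : IsSolution α z g g') :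
    IsSolution α z (f - g) (f' - g') where
  continuous := hf.continuous.sub hg.continuous
  hasDerivAt x hx := (hf.hasDerivAt x hx).sub (hg.hasDerivAt x hx)
  equation x hx := ((hf.equation x hx).sub (hg.equation x hx)).congr_deriv (by
    simp only [Pi.sub_apply]; ring)
  jump n := by
    obtain ⟨fl, fr, hfl, hfr, hf'⟩ := hf.jump n
    obtain ⟨gl, gr, hgl, hgr, hg'⟩ := hg.jump n
    refine ⟨fl - gl, fr - gr, hfl.sub hgl, hfr.sub hgr, ?_⟩
    simp only [Pi.sub_apply]
    linear_combination hf' - hg'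

theorem IsSolution.norm_deriv_le (hf : IsSolution α z f f') {n : ℤ} {B : ℝ}
    (hB : ∀ y ∈ Set.Ioo (n : ℝ) (n + 1), ‖f y‖ ≤ B) {x : ℝ} (hx : x ∈ Set.Ioo (n : ℝ) (n + 1)) :
    ‖f' x‖ ≤ (8 + ‖z‖ ^ 2) * B := by
  rw [add_mul]
  refine norm_deriv_le_of_norm_le_of_norm_deriv2_le
    (fun t ht => hf.hasDerivAt t (notMem_range_intCast_of_mem_Ioo ht))
    (fun t ht => hf.equation t (notMem_range_intCast_of_mem_Ioo ht)) hB (fun t ht => ?_) hx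
  rw [norm_neg, norm_mul, norm_pow]
  gcongr
  exact hB t ht

theorem IsSolution.wronskian_const (hf : IsSolution α z f f') (hg : IsSolution α z g g') :
    ∃ c : ℂ, ∀ x : ℝ, x ∉ Set.range ((↑) : ℤ → ℝ) → f x * g' x - f' x * g x = c := by
  refine exists_eq_const_of_hasDerivAt_zero_off_countable (w := fun x => f x * g' x - f' x * g x)
    (Set.countable_range _) Int.isClosedEmbedding_coe_real.isClosed_range (fun x hx => ?_) ?_
  · exact (((hf.hasDerivAt x hx).mul (hg.equation x hx)).sub
      ((hf.equation x hx).mul (hg.hasDerivAt x hx))).congr_deriv (by ring)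
  · rintro _ ⟨n, rfl⟩
    obtain ⟨fl, fr, hfl, hfr, hf'⟩ := hf.jump n
    obtain ⟨gl, gr, hgl, hgr, hg'⟩ := hg.jump n
    have hfc (s : Set ℝ) : Tendsto f (𝓝[s] (n : ℝ)) (𝓝 (f n)) :=
      (hf.continuous.tendsto _).mono_left nhdsWithin_le_nhds
    have hgc (s : Set ℝ) : Tendsto g (𝓝[s] (n : ℝ)) (𝓝 (g n)) :=
      (hg.continuous.tendsto _).mono_left nhdsWithin_le_nhds
    -- The jumps `α n f(n)` of `f'` and `α n g(n)` of `g'` cancel in the Wronskian.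
    have hcancel : f n * gr - fr * g n = f n * gl - fl * g n := by
      linear_combination f n * hg' - g n * hf'
    refine ⟨f n * gl - fl * g n, ?_⟩
    rw [punctured_nhds_eq_nhdsWithin_sup_nhdsWithin, tendsto_sup]
    exact ⟨((hfc _).mul hgl).sub (hfl.mul (hgc _)),
      hcancel ▸ ((hfc _).mul hgr).sub (hfr.mul (hgc _))⟩

theorem IsSolution.wronskian_eq_zero (hf : IsSolution α z f f') (hg : IsSolution α z g g')
    {B : ℝ} (hfB : ∀ᶠ x in atTop, ‖f x‖ ≤ B) (hg0 : Tendsto g atTop (𝓝 0)) {x : ℝ}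
    (hx : x ∉ Set.range ((↑) : ℤ → ℝ)) : f x * g' x - f' x * g x = 0 := by
  obtain ⟨c, hc⟩ := hf.wronskian_const hg
  rw [hc x hx, ← norm_le_zero_iff]
  have hbound : ∀ δ > 0, ‖c‖ ≤ 2 * (8 + ‖z‖ ^ 2) * B * δ := by
    intro δ hδ
    obtain ⟨X, hX⟩ := eventually_atTop.1 (hfB.and ((Metric.tendsto_nhds.1 hg0) δ hδ))
    obtain ⟨n, hn⟩ := exists_int_gt X
    have hm : (n : ℝ) + 1 / 2 ∈ Set.Ioo (n : ℝ) (n + 1) := ⟨by linarith, by linarith⟩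
    have hf_le : ∀ y ∈ Set.Ioo (n : ℝ) (n + 1), ‖f y‖ ≤ B := fun y hy =>
      (hX y (hn.trans hy.1).le).1
    have hg_le : ∀ y ∈ Set.Ioo (n : ℝ) (n + 1), ‖g y‖ ≤ δ := fun y hy => by
      simpa using (hX y (hn.trans hy.1).le).2.le
    have hB : 0 ≤ B := (norm_nonneg _).trans (hf_le _ hm)
    rw [← hc _ (notMem_range_intCast_of_mem_Ioo hm)]
    calc ‖_‖ ≤ ‖f (n + 1 / 2)‖ * ‖g' (n + 1 / 2)‖ + ‖f' (n + 1 / 2)‖ * ‖g (n + 1 / 2)‖ := by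
          rw [← norm_mul, ← norm_mul]
          exact norm_sub_le _ _
      _ ≤ B * ((8 + ‖z‖ ^ 2) * δ) + (8 + ‖z‖ ^ 2) * B * δ := by
          gcongr
          · exact hf_le _ hm
          · exact hg.norm_deriv_le hg_le hm
          · exact hf.norm_deriv_le hf_le hm
          · exact hg_le _ hm
      _ = 2 * (8 + ‖z‖ ^ 2) * B * δ := by ring
  have hlim : Tendsto (fun δ => 2 * (8 + ‖z‖ ^ 2) * B * δ) (𝓝[>] 0) (𝓝 0) :=
    tendsto_nhdsWithin_of_tendsto_nhds (Continuous.tendsto' (by fun_prop) _ _ (mul_zero _))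
  exact ge_of_tendsto hlim (eventually_mem_nhdsWithin.mono hbound)

theorem IsSolution.tendsto_deriv_nhdsLT_of_eq_zero (hf : IsSolution α z f f') {N : ℤ}
    (h : ∀ x : ℝ, N ≤ x → f x = 0) : Tendsto f' (𝓝[<] (N : ℝ)) (𝓝 0) := by
  obtain ⟨dl, dr, hl, hr, hjump⟩ := hf.jump N
  have hdr : dr = 0 := by
    refine tendsto_nhds_unique hr (tendsto_const_nhds.congr' ?_)
    filter_upwards [Ioo_mem_nhdsGT (lt_add_one (N : ℝ))] with x hx
    refine HasDerivAt.unique ?_ (hf.hasDerivAt x (notMem_range_intCast_of_mem_Ioo hx))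
    refine (hasDerivAt_const x (0 : ℂ)).congr_of_eventuallyEq ?_
    filter_upwards [Ioi_mem_nhds hx.1] with y hy
    exact h y (le_of_lt hy)
  have hdl : dl = 0 := by simpa [hdr, h N le_rfl] using hjump
  exact hdl ▸ hl

-- The equation factors as `(∂ + iz)(∂ - iz) f = 0`: solve it backwards from `N`, factor by factor.
theorem IsSolution.eq_zero_of_sub_one_le (hf : IsSolution α z f f') {N : ℤ}
    (h : ∀ x : ℝ, N ≤ x → f x = 0) : ∀ x : ℝ, N - 1 ≤ x → f x = 0 := by
  have hmem : ∀ x ∈ Set.Ioo ((N : ℝ) - 1) N, x ∉ Set.range ((↑) : ℤ → ℝ) := fun x hx =>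
    notMem_range_intCast_of_mem_Ioo (n := N - 1) (by push_cast; simpa using hx)
  have hf0 : Tendsto f (𝓝[<] (N : ℝ)) (𝓝 0) :=
    h N le_rfl ▸ (hf.continuous.tendsto (N : ℝ)).mono_left nhdsWithin_le_nhds
  have hfactor : ∀ x ∈ Set.Ioo ((N : ℝ) - 1) N, f' x - Complex.I * z * f x = 0 := by
    refine eq_zero_of_hasDerivAt_const_mul (c := -(Complex.I * z)) (fun x hx => ?_) ?_
    · refine ((hf.equation x (hmem x hx)).sub
        ((hf.hasDerivAt x (hmem x hx)).const_mul (Complex.I * z))).congr_deriv ?_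
      linear_combination (-z ^ 2 * f x) * Complex.I_sq
    · simpa using (hf.tendsto_deriv_nhdsLT_of_eq_zero h).sub (hf0.const_mul (Complex.I * z))
  have hIoo : ∀ x ∈ Set.Ioo ((N : ℝ) - 1) N, f x = 0 :=
    eq_zero_of_hasDerivAt_const_mul (fun x hx =>
      (hf.hasDerivAt x (hmem x hx)).congr_deriv (sub_eq_zero.1 (hfactor x hx))) hf0
  have hIcc : Set.Icc ((N : ℝ) - 1) N ⊆ {x | f x = 0} := by
    rw [← closure_Ioo (sub_one_lt (N : ℝ)).ne]
    exact closure_minimal hIoo (isClosed_eq hf.continuous continuous_const)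
  intro x hx
  rcases le_total x N with hxN | hxN
  · exact hIcc ⟨hx, hxN⟩
  · exact h x hxN

theorem IsSolution.eq_zero_of_eventually (hf : IsSolution α z f f')
    (h : ∀ᶠ x in atTop, f x = 0) : f = 0 := by
  obtain ⟨X, hX⟩ := eventually_atTop.1 h
  obtain ⟨N, hN⟩ := exists_int_gt X
  have hback : ∀ k : ℕ, ∀ x : ℝ, ((N - k : ℤ) : ℝ) ≤ x → f x = 0 := by
    intro k
    induction k with
    | zero =>
      intro x hx
      exact hX x (hN.le.trans (by simpa using hx))
    | succ k ih =>
      intro x hx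
      refine hf.eq_zero_of_sub_one_le ih x (le_trans (le_of_eq ?_) hx)
      push_cast
      ring
  ext x
  obtain ⟨k, hk⟩ := exists_nat_ge ((N : ℝ) - x)
  exact hback k x (by push_cast; linarith)

theorem IsSolution.eq_zero_of_tendsto_zero (hf : IsSolution α z f f') (hg : IsSolution α z g g')
    {b B : ℝ} (hb : 0 < b) (hfb : ∀ᶠ x in atTop, b ≤ ‖f x‖) (hfB : ∀ᶠ x in atTop, ‖f x‖ ≤ B)
    (hg0 : Tendsto g atTop (𝓝 0)) : g = 0 := by
  obtain ⟨X, hX⟩ := eventually_atTop.1 hfb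
  have hne : ∀ x, X ≤ x → f x ≠ 0 := fun x hx => norm_pos_iff.1 (hb.trans_le (hX x hx))
  have hratio : ∀ x y, X ≤ x → x ≤ y → g y / f y = g x / f x := by
    intro x y hx hxy
    have := integral_eq_of_hasDerivAt_off_countable_of_le (fun t => g t / f t) (fun _ => 0) hxy
      (Set.countable_range ((↑) : ℤ → ℝ))
      (hg.continuous.continuousOn.div hf.continuous.continuousOn fun t ht => hne t (hx.trans ht.1))
      (fun t ht => by
        refine ((hg.hasDerivAt t ht.2).div (hf.hasDerivAt t ht.2)
          (hne t (hx.trans ht.1.1.le))).congr_deriv (div_eq_zero_iff.2 (Or.inl ?_))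
        linear_combination hf.wronskian_eq_zero hg hfB hg0 ht.2)
      (by simp)
    rw [intervalIntegral.integral_zero] at this
    exact sub_eq_zero.1 this.symm
  have hlim : Tendsto (fun y => g y / f y) atTop (𝓝 0) := by
    refine squeeze_zero_norm' (a := fun y => ‖g y‖ / b) ?_ (by simpa using hg0.norm.div_const b)
    filter_upwards [eventually_ge_atTop X] with y hy
    rw [norm_div]
    gcongr
    exact hX y hy
  refine hg.eq_zero_of_eventually (eventually_atTop.2 ⟨X, fun x hx => ?_⟩)
  have hzero : g x / f x = 0 := by
    refine tendsto_nhds_unique (tendsto_const_nhds.congr' ?_) hlim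
    filter_upwards [eventually_ge_atTop x] with y hy
    exact (hratio x y hx hy).symm
  exact (div_eq_zero_iff.1 hzero).resolve_right (hne x hx)

theorem comap_one_mul_atTop : comap (fun x : ℝ => (1 : ℝ) * x) atTop = atTop := by
  simp only [one_mul, comap_id']

theorem norm_plane_wave (l x : ℝ) : ‖Complex.exp (Complex.I * (1 : ℝ) * l * x)‖ = 1 := by
  have : Complex.I * (1 : ℝ) * l * x = ((l * x : ℝ) : ℂ) * Complex.I := by push_cast; ring
  rw [this, Complex.norm_exp_ofReal_mul_I]

theorem isEquivalent_plane_wave_iff {l : ℝ} {f : ℝ → ℂ} :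
    Asymptotics.IsEquivalent (comap (fun x : ℝ => (1 : ℝ) * x) atTop) f
      (fun x : ℝ => Complex.exp (Complex.I * (1 : ℝ) * l * x)) ↔
    Tendsto (fun x : ℝ => f x - Complex.exp (Complex.I * (1 : ℝ) * l * x)) atTop (𝓝 0) := by
  have hnorm := Asymptotics.isLittleO_norm_right (l := atTop)
    (f := fun x : ℝ => f x - Complex.exp (Complex.I * (1 : ℝ) * l * x))
    (g' := fun x : ℝ => Complex.exp (Complex.I * (1 : ℝ) * l * x))
  simp only [norm_plane_wave] at hnorm
  rw [comap_one_mul_atTop, ← Asymptotics.isLittleO_one_iff ℝ]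
  exact hnorm.symm

theorem IsJostSolution.tendsto_norm {l : ℝ} (h : IsJostSolution α 1 l f) :
    Tendsto (fun x => ‖f x‖) atTop (𝓝 1) := by
  rw [tendsto_iff_norm_sub_tendsto_zero]
  refine squeeze_zero (fun _ => norm_nonneg _) (fun x => ?_)
    (tendsto_zero_iff_norm_tendsto_zero.1 (isEquivalent_plane_wave_iff.1 h.asymptotic))
  simpa only [norm_plane_wave, Real.norm_eq_abs] using
    abs_norm_sub_norm_le (f x) (Complex.exp (Complex.I * (1 : ℝ) * l * x))

theorem IsJostSolution.unique {l : ℝ} (hf : IsJostSolution α 1 l f)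
    (hg : IsJostSolution α 1 l g) : f = g := by
  refine sub_eq_zero.1 (hf.isSolution.eq_zero_of_tendsto_zero (hf.isSolution.sub hg.isSolution)
    (b := 1 / 2) (B := 2) (by norm_num) (hf.tendsto_norm.eventually_const_le (by norm_num))
    (hf.tendsto_norm.eventually_le_const (by norm_num)) ?_)
  simpa [Pi.sub_def] using (isEquivalent_plane_wave_iff.1 hf.asymptotic).sub
    (isEquivalent_plane_wave_iff.1 hg.asymptotic)

end Solution

section Extension

variable {P : Measure (ℝ × ℂ)} {α : ℤ → ℝ} {p : ℕ} {N n : ℤ} {φ : ℝ → ℂ} {C x : ℝ}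

theorem continuous_pairing_translate (h : Integrable Prod.snd P) (hφ : Continuous φ)
    (hC : ∀ s, ‖φ s‖ ≤ C) : Continuous fun r : ℝ => pairing P fun s => φ (r + s) := by
  refine continuous_of_dominated (bound := fun q => ‖q.2‖ * C)
    (fun r => Continuous.aestronglyMeasurable (by fun_prop)) (fun r => Eventually.of_forall
      fun q => ?_) (h.norm.mul_const _) (Eventually.of_forall fun q => by fun_prop)
  rw [norm_mul]
  gcongr
  exact hC _

/-- The strengths of the delta interactions at the sites `n ≥ N`. -/
noncomputable def tail (α : ℤ → ℝ) (N : ℤ) : ℤ → ℝ := (Set.Ici N).indicator α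

theorem tail_of_le (h : N ≤ n) : tail α N n = α n :=
  Set.indicator_of_mem (Set.mem_Ici.2 h) _

theorem tail_of_lt (h : n < N) : tail α N n = 0 :=
  Set.indicator_of_notMem (by simpa using h) _

theorem tail_sub_tail_succ (α : ℤ → ℝ) (N n : ℤ) :
    tail α N n - tail α (N + 1) n = if n = N then α n else 0 := by
  rcases lt_trichotomy n N with h | rfl | h
  · rw [tail_of_lt h, tail_of_lt (by omega), if_neg h.ne, sub_zero]
  · rw [tail_of_le le_rfl, tail_of_lt (by omega), if_pos rfl, sub_zero]
  · rw [tail_of_le h.le, tail_of_le (by omega), if_neg h.ne', sub_self]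

/-- Encodes the sum over `n ≥ N` of the translates by `t n` of the complex measures encoded by
`jostMeasure α n`, with the coefficients `c * α n`. -/
noncomputable def shiftSum (α : ℤ → ℝ) (N : ℤ) (c : ℝ) (t : ℤ → ℝ) : Measure (ℝ × ℂ) :=
  Measure.sum fun n : ℤ => convDensity (Measure.dirac (t n)) (fun _ => ↑(c * tail α N n))
    (jostMeasure α n)

instance (α : ℤ → ℝ) (N : ℤ) (c : ℝ) (t : ℤ → ℝ) : SFinite (shiftSum α N c t) := by
  unfold shiftSum; infer_instance

theorem mass_shiftSum_le (h : WeightSummable α (p + 1)) (c : ℝ) {t : ℤ → ℝ}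
    (ht : ∀ n, N ≤ n → (1 + |t n|) ^ p ≤ (1 + |(n : ℝ)|) ^ p) :
    mass p (shiftSum α N c t) ≤
      ENNReal.ofReal (|c| * majorant α p N * ∑' n : ℤ, |α n| * (1 + |(n : ℝ)|) ^ p) := by
  have hW := majorant_nonneg α p N
  rw [shiftSum, mass_sum, ← tsum_mul_left, ENNReal.ofReal_tsum_of_nonneg
    (fun n => by positivity) ((h.mono p.le_succ).mul_left _)]
  refine ENNReal.tsum_le_tsum fun n => (mass_convDensity_le p measurable_const _).trans ?_
  rw [lintegral_dirac]
  rcases le_or_gt N n with hn | hn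
  · have hmass : mass p (jostMeasure α n) ≤ ENNReal.ofReal (majorant α p N) :=
      (mass_jostMeasure_le h n).trans (ENNReal.ofReal_le_ofReal
        (majorant_anti h (by exact_mod_cast hn)))
    have hweight : (1 + ‖t n‖ₑ) ^ p = ENNReal.ofReal ((1 + |t n|) ^ p) := by
      rw [ENNReal.ofReal_pow (by positivity), ENNReal.ofReal_add zero_le_one (by positivity),
        ENNReal.ofReal_one, Real.enorm_eq_ofReal_abs]
    have hcoef : ‖((c * α n : ℝ) : ℂ)‖ₑ = ENNReal.ofReal (|c| * |α n|) := by
      rw [← ofReal_norm, Complex.norm_real, Real.norm_eq_abs, abs_mul]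
    calc ‖((c * tail α N n : ℝ) : ℂ)‖ₑ * (1 + ‖t n‖ₑ) ^ p * mass p (jostMeasure α n)
        ≤ ENNReal.ofReal (|c| * |α n|) * ENNReal.ofReal ((1 + |(n : ℝ)|) ^ p) *
            ENNReal.ofReal (majorant α p N) := by
          rw [tail_of_le hn, hweight, hcoef]
          exact mul_le_mul' (mul_le_mul' le_rfl (ENNReal.ofReal_le_ofReal (ht n hn))) hmass
      _ = ENNReal.ofReal (|c| * majorant α p N * (|α n| * (1 + |(n : ℝ)|) ^ p)) := by
          rw [← ENNReal.ofReal_mul (by positivity), ← ENNReal.ofReal_mul (by positivity)]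
          ring_nf
  · simp [tail_of_lt hn]

theorem integrable_snd_shiftSum (h : WeightSummable α 1) (N : ℤ) (c : ℝ) (t : ℤ → ℝ) :
    Integrable Prod.snd (shiftSum α N c t) :=
  integrable_snd_of_mass_ne_top (ne_top_of_le_ne_top ENNReal.ofReal_ne_top
    (mass_shiftSum_le (p := 0) h c fun _ _ => by simp only [pow_zero, le_refl]))

theorem hasSum_pairing_shiftSum (h : WeightSummable α 1) (N : ℤ) (c : ℝ) (t : ℤ → ℝ)
    (hφ : Measurable φ) (hC : ∀ s, ‖φ s‖ ≤ C) :
    HasSum (fun n : ℤ => ((c * tail α N n : ℝ) : ℂ) *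
      pairing (jostMeasure α n) fun s => φ (t n + s)) (pairing (shiftSum α N c t) φ) := by
  have hint := integrable_snd_shiftSum h N c t
  rw [shiftSum] at hint ⊢
  convert hasSum_pairing hint hφ hC using 2 with n
  rw [pairing_convDensity measurable_const (integrable_const _) (integrable_snd_jostMeasure h n)
    hφ hC, integral_dirac]

/-- For `x` in `[N - 1, N]` this is the pairing of `scatteringMeasure α x` with `φ`. Since the set
of sites involved is fixed, it is differentiable in `x` on the whole line. -/
noncomputable def scatteringExtension (α : ℤ → ℝ) (N : ℤ) (φ : ℝ → ℂ) (x : ℝ) : ℂ :=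
  ∑' n : ℤ, ((Real.pi * tail α N n : ℝ) : ℂ) * ∫ r in (0 : ℝ)..((n - x) / Real.pi),
    pairing (jostMeasure α n) fun s => φ (r + s)

theorem hasSum_scatteringExtension (h : WeightSummable α 1) (hx : x ∈ Set.Icc ((N : ℝ) - 1) N)
    (hφ : Measurable φ) (hC : ∀ s, ‖φ s‖ ≤ C) :
    HasSum (fun n : ℤ => ((Real.pi * tail α N n : ℝ) : ℂ) *
      ∫ r in (0 : ℝ)..((n - x) / Real.pi), pairing (jostMeasure α n) fun s => φ (r + s))
      (pairing (scatteringMeasure α x) φ) := by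
  convert hasSum_pairing_scatteringMeasure h x hφ hC using 2 with n
  have hpi := Real.pi_pos
  rcases le_or_gt N n with hn | hn
  · have hn' : (N : ℝ) ≤ n := by exact_mod_cast hn
    rw [tail_of_le hn, intervalIntegral.integral_of_le (div_nonneg (by linarith [hx.2]) hpi.le)]
  · have hn' : (n : ℝ) ≤ N - 1 := by exact_mod_cast Int.le_sub_one_of_lt hn
    have hle : ((n : ℝ) - x) / Real.pi ≤ 0 :=
      div_nonpos_of_nonpos_of_nonneg (by linarith [hx.1]) hpi.le
    rw [tail_of_lt hn, Set.Ioc_eq_empty hle.not_gt]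
    simp

theorem pairing_scatteringMeasure (h : WeightSummable α 1) (hx : x ∈ Set.Icc ((N : ℝ) - 1) N)
    (hφ : Measurable φ) (hC : ∀ s, ‖φ s‖ ≤ C) :
    pairing (scatteringMeasure α x) φ = scatteringExtension α N φ x :=
  (hasSum_scatteringExtension h hx hφ hC).tsum_eq.symm

theorem hasDerivAt_integral_div_pi {G : ℝ → ℂ} (hG : Continuous G) (a b x : ℝ) :
    HasDerivAt (fun y : ℝ => ((Real.pi * a : ℝ) : ℂ) * ∫ r in (0 : ℝ)..((b - y) / Real.pi), G r)
      (((-1 * a : ℝ) : ℂ) * G ((b - x) / Real.pi)) x := by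
  have hpi : (Real.pi : ℂ) ≠ 0 := by exact_mod_cast Real.pi_pos.ne'
  have hint := intervalIntegral.integral_hasDerivAt_right
    (hG.intervalIntegrable 0 ((b - x) / Real.pi))
    hG.stronglyMeasurable.stronglyMeasurableAtFilter hG.continuousAt
  have hend : HasDerivAt (fun y : ℝ => (b - y) / Real.pi) (-1 / Real.pi) x :=
    ((hasDerivAt_id x).const_sub b).div_const Real.pi
  refine ((hint.scomp x hend).const_mul ((Real.pi * a : ℝ) : ℂ)).congr_deriv ?_
  rw [Complex.real_smul]
  push_cast
  field_simp

theorem norm_tail_mul_pairing_le (h : WeightSummable α 1) (N n : ℤ) (hC : ∀ s, ‖φ s‖ ≤ C)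
    (t : ℝ) :
    ‖((-1 * tail α N n : ℝ) : ℂ) * pairing (jostMeasure α n) fun s => φ (t + s)‖ ≤
      C * majorant α 0 N * (|α n| * (1 + |(n : ℝ)|) ^ 1) := by
  have hW := majorant_nonneg α 0 N
  have hC0 : 0 ≤ C := (norm_nonneg _).trans (hC 0)
  rcases le_or_gt N n with hn | hn
  · have hpair : ‖pairing (jostMeasure α n) fun s => φ (t + s)‖ ≤ C * majorant α 0 N :=
      (norm_pairing_jostMeasure_le h n fun s => hC _).trans
        (mul_le_mul_of_nonneg_left (majorant_anti h (by exact_mod_cast hn)) hC0)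
    rw [norm_mul, tail_of_le hn, Complex.norm_real, neg_one_mul, norm_neg, Real.norm_eq_abs,
      mul_comm]
    gcongr
    exact le_mul_of_one_le_right (abs_nonneg _) (by simp)
  · simp only [tail_of_lt hn, mul_zero, Complex.ofReal_zero, zero_mul, norm_zero]
    positivity

theorem hasDerivAt_scatteringExtension (h : WeightSummable α 1) (N : ℤ) (hφ : Continuous φ)
    (hC : ∀ s, ‖φ s‖ ≤ C) (x : ℝ) :
    HasDerivAt (scatteringExtension α N φ)
      (pairing (shiftSum α N (-1) fun n => (n - x) / Real.pi) φ) x := by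
  rw [← (hasSum_pairing_shiftSum h N (-1) _ hφ.measurable hC).tsum_eq]
  exact hasDerivAt_tsum (h.mul_left (C * majorant α 0 N))
    (fun n y => hasDerivAt_integral_div_pi
      (continuous_pairing_translate (integrable_snd_jostMeasure h n) hφ hC) (tail α N n) n y)
    (fun n y => norm_tail_mul_pairing_le h N n hC _)
    (hasSum_scatteringExtension h (x := N) (by simp) hφ.measurable hC).summable x

end Extension

section Gluing

variable {E : Type*} [NormedAddCommGroup E] [NormedSpace ℝ E] {f g : ℝ → E} {d : E} {a b x : ℝ}

theorem hasDerivWithinAt_Iic_of_eqOn (hfg : Set.EqOn f g (Set.Icc a b)) (hg : HasDerivAt g d x)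
    (hx : x ∈ Set.Ioc a b) : HasDerivWithinAt f d (Set.Iic x) x := by
  refine hg.hasDerivWithinAt.congr_of_eventuallyEq ?_ (hfg ⟨hx.1.le, hx.2⟩)
  filter_upwards [Icc_mem_nhdsLE hx.1] with y hy using hfg ⟨hy.1, hy.2.trans hx.2⟩

theorem hasDerivWithinAt_Ici_of_eqOn (hfg : Set.EqOn f g (Set.Icc a b)) (hg : HasDerivAt g d x)
    (hx : x ∈ Set.Ico a b) : HasDerivWithinAt f d (Set.Ici x) x := by
  refine hg.hasDerivWithinAt.congr_of_eventuallyEq ?_ (hfg ⟨hx.1, hx.2.le⟩)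
  filter_upwards [Icc_mem_nhdsGE hx.2] with y hy using hfg ⟨hx.1.trans hy.1, hy.2⟩

theorem mem_Ioc_ceil (x : ℝ) : x ∈ Set.Ioc ((⌈x⌉ : ℝ) - 1) ⌈x⌉ :=
  ⟨by linarith [Int.ceil_lt_add_one x], Int.le_ceil x⟩

theorem mem_Ico_floor_add_one (x : ℝ) :
    x ∈ Set.Ico (((⌊x⌋ + 1 : ℤ) : ℝ) - 1) (⌊x⌋ + 1 : ℤ) := by
  push_cast
  exact ⟨by linarith [Int.floor_le x], Int.lt_floor_add_one x⟩

theorem IsJostSolution.of_pieces {α : ℤ → ℝ} {ε : ℝ} {z : ℂ} {f : ℝ → ℂ} {F F' : ℤ → ℝ → ℂ}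
    (hf : ∀ N : ℤ, Set.EqOn f (F N) (Set.Icc ((N : ℝ) - 1) N))
    (hF : ∀ N x, HasDerivAt (F N) (F' N x) x)
    (hF' : ∀ N x, HasDerivAt (F' N) (-(z ^ 2 * F N x)) x)
    (hjump : ∀ n : ℤ, F' (n + 1) n - F' n n = α n * f n)
    (hasymp : Asymptotics.IsEquivalent (comap (fun x : ℝ => ε * x) atTop) f
      (fun x : ℝ => Complex.exp (Complex.I * ε * z * x))) :
    IsJostSolution α ε z f := by
  have hderiv : ∀ N : ℤ, ∀ x ∈ Set.Ioo ((N : ℝ) - 1) N, HasDerivAt f (F' N x) x := fun N x hx =>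
    (hF N x).congr_of_eventuallyEq (by
      filter_upwards [Icc_mem_nhds hx.1 hx.2] with y hy using hf N hy)
  have hoff : ∀ x : ℝ, x ∉ Set.range ((↑) : ℤ → ℝ) → x ∈ Set.Ioo ((⌈x⌉ : ℝ) - 1) ⌈x⌉ := fun x hx =>
    ⟨(mem_Ioc_ceil x).1, (mem_Ioc_ceil x).2.lt_of_ne fun h => hx ⟨_, h.symm⟩⟩
  have hlim : ∀ N : ℤ, ∀ (s : Set ℝ) (x : ℝ), Tendsto (F' N) (𝓝[s] x) (𝓝 (F' N x)) :=
    fun N s x => (hF' N x).continuousAt.tendsto.mono_left nhdsWithin_le_nhds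
  refine ⟨continuous_iff_continuousAt.2 fun x => continuousAt_iff_continuous_left_right.2 ⟨?_, ?_⟩,
    fun x hx => (hderiv _ x (hoff x hx)).differentiableAt, fun x hx => ?_,
    fun n => ⟨F' n n, F' (n + 1) n, ?_, ?_, hjump n⟩, hasymp⟩
  · exact (hasDerivWithinAt_Iic_of_eqOn (hf _) (hF _ x) (mem_Ioc_ceil x)).continuousWithinAt
  · exact (hasDerivWithinAt_Ici_of_eqOn (hf _) (hF _ x)
      (mem_Ico_floor_add_one x)).continuousWithinAt
  · have hx' := hoff x hx
    rw [hf _ ⟨hx'.1.le, hx'.2.le⟩]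
    refine (hF' _ x).congr_of_eventuallyEq ?_
    filter_upwards [Ioo_mem_nhds hx'.1 hx'.2] with y hy using (hderiv _ y hy).deriv
  · refine (hlim n _ _).congr' ?_
    filter_upwards [Ioo_mem_nhdsLT (sub_one_lt (n : ℝ))] with y hy using (hderiv n y hy).deriv.symm
  · refine (hlim (n + 1) _ _).congr' ?_
    filter_upwards [Ioo_mem_nhdsGT (lt_add_one (n : ℝ))] with y hy
    exact (hderiv (n + 1) y (by push_cast; simpa using hy)).deriv.symm

end Gluing

section Existence

variable {α : ℤ → ℝ} {N : ℤ} {l x : ℝ}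

/-- The character `ξ ↦ exp (2 π i l ξ)`; pairing with it is the inverse Fourier transform. -/
noncomputable def character (l ξ : ℝ) : ℂ := Complex.exp (2 * Real.pi * Complex.I * l * ξ)

theorem continuous_character (l : ℝ) : Continuous (character l) := by
  unfold character; fun_prop

theorem norm_character (l ξ : ℝ) : ‖character l ξ‖ = 1 := by
  have : 2 * Real.pi * Complex.I * l * ξ = ((2 * Real.pi * l * ξ : ℝ) : ℂ) * Complex.I := by
    push_cast; ring
  rw [character, this, Complex.norm_exp_ofReal_mul_I]

theorem norm_character_le (l ξ : ℝ) : ‖character l ξ‖ ≤ 1 := (norm_character l ξ).le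

theorem character_add (l ξ η : ℝ) : character l (ξ + η) = character l ξ * character l η := by
  unfold character
  rw [← Complex.exp_add]
  congr 1; push_cast; ring

theorem exp_mul_character_div_pi (l x : ℝ) :
    Complex.exp (-(Complex.I * l) * x) * character l (x / Real.pi) =
      Complex.exp (Complex.I * l * x) := by
  have hpi : (Real.pi : ℂ) ≠ 0 := by exact_mod_cast Real.pi_pos.ne'
  rw [character, ← Complex.exp_add]
  congr 1
  push_cast
  field_simp
  ring

theorem pairing_character_add (P : Measure (ℝ × ℂ)) (l t : ℝ) :
    pairing P (fun s => character l (t + s)) = character l t * pairing P (character l) := by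
  unfold pairing
  rw [← integral_const_mul]
  simp_rw [character_add, mul_left_comm]

/-- The coefficient of the reflected wave of the Jost solution on `[N - 1, N]`. -/
noncomputable def reflectedCoef (α : ℤ → ℝ) (l : ℝ) (N : ℤ) : ℂ :=
  pairing (shiftSum α N 1 fun n => n / Real.pi) (character l)

theorem pairing_shiftSum_character (h : WeightSummable α 1) (N : ℤ) (l x : ℝ) :
    pairing (shiftSum α N (-1) fun n => (n - x) / Real.pi) (character l) =
      -(character l (-x / Real.pi) * reflectedCoef α l N) := by
  have hcoef := hasSum_pairing_shiftSum h N 1 (fun n => n / Real.pi)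
    (continuous_character l).measurable (norm_character_le l)
  have hshift := hasSum_pairing_shiftSum h N (-1) (fun n => (n - x) / Real.pi)
    (continuous_character l).measurable (norm_character_le l)
  rw [← mul_neg]
  refine hshift.unique ((hcoef.neg.mul_left _).congr_fun fun n => ?_)
  rw [pairing_character_add, pairing_character_add, sub_div, sub_eq_neg_add, ← neg_div,
    character_add]
  push_cast
  ring

/-- The Jost function `m₊(l, x)`. -/
noncomputable def mFun (α : ℤ → ℝ) (l x : ℝ) : ℂ := pairing (jostMeasure α x) (character l)

theorem mFun_eq (h : WeightSummable α 1) (l x : ℝ) :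
    mFun α l x = 1 + pairing (scatteringMeasure α x) (character l) := by
  rw [mFun, pairing_jostMeasure h x (continuous_character l).measurable (norm_character_le l)]
  simp [character]

theorem norm_mFun_sub_one_le (h : WeightSummable α 1) (l x : ℝ) :
    ‖mFun α l x - 1‖ ≤ majorant α 0 x - 1 := by
  rw [mFun_eq h, add_sub_cancel_left, ← one_mul (majorant α 0 x - 1)]
  exact norm_pairing_le (sub_nonneg.2 (one_le_majorant α 0 x)) (mass_scatteringMeasure_le h x)
    (norm_character_le l)

theorem reflectedCoef_sub_succ (h : WeightSummable α 1) (l : ℝ) (N : ℤ) :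
    reflectedCoef α l N - reflectedCoef α l (N + 1) =
      α N * (character l (N / Real.pi) * mFun α l N) := by
  have hsum (M : ℤ) := hasSum_pairing_shiftSum h M 1 (fun n => n / Real.pi)
    (continuous_character l).measurable (norm_character_le l)
  refine ((hsum N).sub (hsum (N + 1))).unique ((hasSum_ite_eq N _).congr_fun fun n => ?_)
  rw [← sub_mul, ← Complex.ofReal_sub, ← mul_sub, tail_sub_tail_succ, pairing_character_add,
    one_mul]
  split_ifs with hn
  · rw [hn, mFun]
  · rw [Complex.ofReal_zero, zero_mul]

/-- The solution of the free equation that agrees on `[N - 1, N]` with the Jost solution `f₊`. -/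
noncomputable def jostPiece (α : ℤ → ℝ) (l : ℝ) (N : ℤ) (x : ℝ) : ℂ :=
  Complex.exp (Complex.I * l * x) * (1 + scatteringExtension α N (character l) x)

theorem exp_mul_mFun_eq_jostPiece (h : WeightSummable α 1) (l : ℝ)
    (hx : x ∈ Set.Icc ((N : ℝ) - 1) N) :
    Complex.exp (Complex.I * l * x) * mFun α l x = jostPiece α l N x := by
  rw [jostPiece, mFun_eq h, pairing_scatteringMeasure h hx (continuous_character l).measurable
    (norm_character_le l)]

theorem hasDerivAt_jostPiece (h : WeightSummable α 1) (l : ℝ) (N : ℤ) (x : ℝ) :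
    HasDerivAt (jostPiece α l N) (Complex.I * l * jostPiece α l N x -
      Complex.exp (-(Complex.I * l) * x) * reflectedCoef α l N) x := by
  have hext := (hasDerivAt_scatteringExtension h N (continuous_character l) (norm_character_le l)
    x).const_add 1
  rw [pairing_shiftSum_character h] at hext
  refine ((hasDerivAt_exp_const_mul (Complex.I * l) x).mul hext).congr_deriv ?_
  have hwave := exp_mul_character_div_pi l (-x)
  push_cast at hwave
  rw [mul_neg, neg_mul, neg_neg, mul_neg, ← neg_mul] at hwave
  rw [← hwave, jostPiece]
  ring

theorem hasDerivAt_deriv_jostPiece (h : WeightSummable α 1) (l : ℝ) (N : ℤ) (x : ℝ) :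
    HasDerivAt (fun y : ℝ => Complex.I * l * jostPiece α l N y -
        Complex.exp (-(Complex.I * l) * y) * reflectedCoef α l N)
      (-((l : ℂ) ^ 2 * jostPiece α l N x)) x := by
  refine (((hasDerivAt_jostPiece h l N x).const_mul (Complex.I * l)).sub
    ((hasDerivAt_exp_const_mul (-(Complex.I * l)) x).mul_const _)).congr_deriv ?_
  linear_combination (l : ℂ) ^ 2 * jostPiece α l N x * Complex.I_sq

theorem isEquivalent_exp_mul_mFun (h : WeightSummable α 1) (l : ℝ) :
    Asymptotics.IsEquivalent (comap (fun x : ℝ => 1 * x) atTop)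
      (fun x : ℝ => Complex.exp (Complex.I * l * x) * mFun α l x)
      (fun x : ℝ => Complex.exp (Complex.I * (1 : ℝ) * l * x)) := by
  rw [isEquivalent_plane_wave_iff]
  have hmaj : Tendsto (fun x => majorant α 0 x - 1) atTop (𝓝 0) := by
    simpa using (tendsto_majorant h).sub_const 1
  refine squeeze_zero_norm (fun x => ?_) hmaj
  have hwave := norm_plane_wave l x
  rw [Complex.ofReal_one, mul_one] at hwave ⊢
  rw [← mul_sub_one, norm_mul, hwave, one_mul]
  exact norm_mFun_sub_one_le h l x

theorem isJostSolution_exp_mul_mFun (h : WeightSummable α 1) (l : ℝ) :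
    IsJostSolution α 1 l fun x => Complex.exp (Complex.I * l * x) * mFun α l x := by
  refine IsJostSolution.of_pieces (fun N x hx => exp_mul_mFun_eq_jostPiece h l hx)
    (hasDerivAt_jostPiece h l) (hasDerivAt_deriv_jostPiece h l) (fun n => ?_)
    (isEquivalent_exp_mul_mFun h l)
  have hright := exp_mul_mFun_eq_jostPiece h l (N := n + 1) (x := n) (by simp)
  have hleft := exp_mul_mFun_eq_jostPiece h l (N := n) (x := n) (by simp)
  rw [← hright, ← hleft, ← exp_mul_character_div_pi]
  linear_combination Complex.exp (-(Complex.I * l) * (n : ℝ)) * reflectedCoef_sub_succ h l n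

theorem existsUnique_isJostSolution (h : WeightSummable α 1) (l : ℝ) :
    ∃! f, IsJostSolution α 1 l f :=
  ⟨_, isJostSolution_exp_mul_mFun h l, fun _ hg => hg.unique (isJostSolution_exp_mul_mFun h l)⟩

theorem mJost_eq_mFun (h : WeightSummable α 1) (l x : ℝ) : mJost α 1 l x = mFun α l x := by
  have hf := isJostSolution_exp_mul_mFun h l
  have hjost : jost α 1 l = _ := IsJostSolution.unique (Classical.epsilon_spec ⟨_, hf⟩) hf
  rw [mJost, hjost, ← mul_assoc, ← Complex.exp_add, Complex.ofReal_one, mul_one, neg_add_cancel,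
    Complex.exp_zero, one_mul]

end Existence

section Fourier

variable {P : Measure (ℝ × ℂ)}

theorem integrable_prod_character (h : Integrable Prod.snd P) (φ : 𝓢(ℝ, ℂ)) :
    Integrable (fun z : (ℝ × ℂ) × ℝ => z.1.2 * φ z.2 * character z.2 z.1.1) (P.prod volume) :=
  (h.mul_prod φ.integrable).mul_bdd (c := 1)
    (Continuous.aestronglyMeasurable (by unfold character; fun_prop))
    (Eventually.of_forall fun _ => norm_character_le _ _)

theorem fourierInv_schwartz_apply (φ : 𝓢(ℝ, ℂ)) (ξ : ℝ) :
    𝓕⁻ φ ξ = ∫ l, φ l * character l ξ := by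
  rw [fourierInv_coe, Real.fourierInv_eq']
  refine integral_congr_ae (Eventually.of_forall fun l => ?_)
  simp only [character, smul_eq_mul, RCLike.inner_apply, conj_trivial]
  rw [mul_comm]
  push_cast
  ring_nf

theorem isGivenBy_fourierInv_toDistribution [SFinite P] (h : Integrable Prod.snd P) :
    IsGivenBy (𝓕⁻ (toDistribution P h)) fun l => pairing P (character l) := by
  intro φ
  have hint := integrable_prod_character h φ
  have hinner (l : ℝ) : ∫ q : ℝ × ℂ, q.2 * φ l * character l q.1 ∂P =
      pairing P (character l) * φ l := by
    rw [pairing, ← integral_mul_const]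
    simp_rw [mul_right_comm]
  refine ⟨hint.integral_prod_right.congr (Eventually.of_forall hinner), ?_⟩
  calc 𝓕⁻ (toDistribution P h) φ = ∫ q : ℝ × ℂ, q.2 * 𝓕⁻ φ q.1 ∂P := by
        rw [TemperedDistribution.fourierInv_apply, toDistribution_apply, pairing]
    _ = ∫ q : ℝ × ℂ, (∫ l : ℝ, q.2 * φ l * character l q.1) ∂P := by
        simp_rw [fourierInv_schwartz_apply, mul_assoc, integral_const_mul]
    _ = ∫ l : ℝ, pairing P (character l) * φ l := by
        rw [integral_integral_swap hint]
        simp_rw [hinner]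

theorem hasDerivAt_pairing_translate (h : Integrable Prod.snd P) (φ : 𝓢(ℝ, ℂ)) (r : ℝ) :
    HasDerivAt (fun r : ℝ => pairing P fun s => φ (r + s))
      (pairing P fun s => SchwartzMap.derivCLM ℂ ℂ φ (r + s)) r := by
  refine (hasDerivAt_integral_of_dominated_loc_of_deriv_le (s := Set.univ)
    (F := fun (r : ℝ) (q : ℝ × ℂ) => q.2 * φ (r + q.1))
    (F' := fun (r : ℝ) (q : ℝ × ℂ) => q.2 * SchwartzMap.derivCLM ℂ ℂ φ (r + q.1))
    (bound := fun q => ‖q.2‖ * SchwartzMap.seminorm ℂ 0 0 (SchwartzMap.derivCLM ℂ ℂ φ))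
    univ_mem (Eventually.of_forall fun r => Continuous.aestronglyMeasurable (by fun_prop))
    (integrable_snd_mul h (by fun_prop) fun s => norm_schwartz_le φ _)
    (Continuous.aestronglyMeasurable (by fun_prop)) (Eventually.of_forall fun q r _ => ?_)
    (h.norm.mul_const _) (Eventually.of_forall fun q r _ => ?_)).2
  · rw [norm_mul]
    gcongr
    exact norm_schwartz_le _ _
  · exact ((φ.hasDerivAt (r + q.1)).comp_add_const r q.1).const_mul _

end Fourier

section Derivatives

variable {α : ℤ → ℝ} {N : ℤ} {x : ℝ}

/-- The Fourier transform of `m₊(·, x) - 1`. -/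
noncomputable def scatteringDistribution (h : WeightSummable α 1) (x : ℝ) : 𝓢'(ℝ, ℂ) :=
  toDistribution (scatteringMeasure α x) (integrable_snd_scatteringMeasure h x)

/-- The tempered distribution `∑_{n ≥ N} c α n μ_n(· - t n)`, where `μ_n` is the Fourier transform
of `m₊(·, n)`. -/
noncomputable def shiftDistribution (h : WeightSummable α 1) (N : ℤ) (c : ℝ) (t : ℤ → ℝ) :
    𝓢'(ℝ, ℂ) :=
  toDistribution (shiftSum α N c t) (integrable_snd_shiftSum h N c t)

theorem eqOn_scatteringDistribution (h : WeightSummable α 1) (N : ℤ) (φ : 𝓢(ℝ, ℂ)) :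
    Set.EqOn (fun x => scatteringDistribution h x φ) (scatteringExtension α N φ)
      (Set.Icc ((N : ℝ) - 1) N) := fun _ hx =>
  pairing_scatteringMeasure h hx φ.continuous.measurable (norm_schwartz_le φ)

theorem hasParamDerivWithin_Iic (h : WeightSummable α 1) (hx : x ∈ Set.Ioc ((N : ℝ) - 1) N) :
    HasParamDerivWithin (scatteringDistribution h)
      (shiftDistribution h N (-1) fun n => (n - x) / Real.pi) (Set.Iic x) x := fun φ =>
  hasDerivWithinAt_Iic_of_eqOn (eqOn_scatteringDistribution h N φ)
    (hasDerivAt_scatteringExtension h N φ.continuous (norm_schwartz_le φ) x) hx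

theorem hasParamDerivWithin_Ici (h : WeightSummable α 1) (hx : x ∈ Set.Ico ((N : ℝ) - 1) N) :
    HasParamDerivWithin (scatteringDistribution h)
      (shiftDistribution h N (-1) fun n => (n - x) / Real.pi) (Set.Ici x) x := fun φ =>
  hasDerivWithinAt_Ici_of_eqOn (eqOn_scatteringDistribution h N φ)
    (hasDerivAt_scatteringExtension h N φ.continuous (norm_schwartz_le φ) x) hx

theorem integral_pairing_deriv {P : Measure (ℝ × ℂ)} (h : Integrable Prod.snd P) (φ : 𝓢(ℝ, ℂ))
    (a b : ℝ) :
    ∫ r in a..b, pairing P (fun s => SchwartzMap.derivCLM ℂ ℂ φ (r + s)) =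
      pairing P (fun s => φ (b + s)) - pairing P (fun s => φ (a + s)) :=
  intervalIntegral.integral_eq_sub_of_hasDerivAt
    (fun r _ => hasDerivAt_pairing_translate h φ r)
    ((continuous_pairing_translate h (SchwartzMap.continuous _)
      (norm_schwartz_le (SchwartzMap.derivCLM ℂ ℂ φ))).intervalIntegrable _ _)

theorem derivCLM_scatteringDistribution (h : WeightSummable α 1)
    (hx : x ∈ Set.Icc ((N : ℝ) - 1) N) :
    TemperedDistribution.derivCLM ℂ (scatteringDistribution h x) =
      shiftDistribution h N (-Real.pi) (fun n => (n - x) / Real.pi) +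
        shiftDistribution h N Real.pi fun _ => 0 := by
  ext φ
  have hshift (c : ℝ) (t : ℤ → ℝ) :=
    hasSum_pairing_shiftSum h N c t φ.continuous.measurable (norm_schwartz_le φ)
  have hscat := hasSum_scatteringExtension h hx (SchwartzMap.continuous _).measurable
    (norm_schwartz_le (SchwartzMap.derivCLM ℂ ℂ φ))
  rw [TemperedDistribution.derivCLM_apply_apply, map_neg]
  refine hscat.neg.unique (((hshift _ _).add (hshift _ _)).congr_fun fun n => ?_)
  rw [integral_pairing_deriv (integrable_snd_jostMeasure h n)]
  push_cast
  ring

end Derivatives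

section UniformBounds

variable {ε : ℝ} {p : ℕ} {T T' : ℝ → 𝓢'(ℝ, ℂ)}

/-- The tempered distributions `T x` with `ε x ≥ 0` are given by complex measures whose total
variations with the weight `(1 + |ξ|)^p` are bounded. -/
def UniformRep (ε : ℝ) (p : ℕ) (T : ℝ → 𝓢'(ℝ, ℂ)) : Prop :=
  ∃ C : ℝ≥0, ∀ x : ℝ, 0 ≤ ε * x → HasRep p C (T x)

theorem UniformRep.boundedTV (h : UniformRep ε p T) : BoundedTV ε p T := by
  obtain ⟨C, hC⟩ := h
  exact (iSup₂_le fun x hx => (hC x hx).tvNorm_mulPow_le).trans_lt ENNReal.coe_lt_top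

theorem UniformRep.add (h : UniformRep ε p T) (h' : UniformRep ε p T') :
    UniformRep ε p fun x => T x + T' x := by
  obtain ⟨C, hC⟩ := h
  obtain ⟨C', hC'⟩ := h'
  exact ⟨C + C', fun x hx => (hC x hx).add (hC' x hx)⟩

theorem UniformRep.conv (h : UniformRep ε p T) (g : 𝓢(ℝ, ℂ)) :
    UniformRep ε p fun x => conv g (T x) := by
  obtain ⟨C, hC⟩ := h
  exact ⟨weightedNorm p g * C, fun x hx => (hC x hx).conv g⟩

theorem HasRep.neg {C : ℝ≥0} {T : 𝓢'(ℝ, ℂ)} (h : HasRep p C T) : HasRep p C (-T) := by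
  obtain ⟨P, _, hm, hT⟩ := h
  refine ⟨convDensity (Measure.dirac 0) (fun _ => -1) P, inferInstance,
    (mass_convDensity_le p measurable_const P).trans (by simpa using hm), fun φ => ?_⟩
  rw [pairing_convDensity measurable_const (integrable_const _)
    (integrable_snd_of_mass_ne_top (ne_top_of_le_ne_top ENNReal.coe_ne_top hm))
    φ.continuous.measurable (norm_schwartz_le φ), integral_dirac]
  simp [← hT]

theorem UniformRep.neg (h : UniformRep ε p T) : UniformRep ε p fun x => -T x := by
  obtain ⟨C, hC⟩ := h
  exact ⟨C, fun x hx => (hC x hx).neg⟩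

theorem UniformRep.comp_neg (h : UniformRep ε p T) : UniformRep (-ε) p fun x => T (-x) := by
  obtain ⟨C, hC⟩ := h
  exact ⟨C, fun x hx => hC (-x) (by rwa [mul_neg, ← neg_mul])⟩

/-- The three bounds on `T`, `∂_x T` and `∂_ξ T` in terms of representing measures. In this form
they are inherited by convolutions, since `∂_ξ (g ∗ T) = g' ∗ T`. -/
structure HasUniformBounds (ε : ℝ) (p : ℕ) (T : ℝ → 𝓢'(ℝ, ℂ)) : Prop where
  uniformRep : UniformRep ε p T
  derivParam : ∃ Dl Dr : ℝ → 𝓢'(ℝ, ℂ),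
    (∀ x : ℝ, 0 ≤ ε * x → HasParamDerivWithin T (Dl x) (Set.Iic x) x ∧
      HasParamDerivWithin T (Dr x) (Set.Ici x) x) ∧
    (∀ x : ℝ, 0 ≤ ε * x → x ∉ Set.range ((↑) : ℤ → ℝ) → Dl x = Dr x) ∧
    UniformRep ε p Dl ∧ UniformRep ε p Dr
  deriv : UniformRep ε p fun x => TemperedDistribution.derivCLM ℂ (T x)

theorem HasUniformBounds.bounded (h : HasUniformBounds ε p T) :
    BoundedTV ε p T ∧ BoundedTVDerivParam ε p T ∧ BoundedTVDeriv ε p T := by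
  obtain ⟨Dl, Dr, hderiv, heq, hl, hr⟩ := h.derivParam
  exact ⟨h.uniformRep.boundedTV, ⟨Dl, Dr, hderiv, heq, hl.boundedTV, hr.boundedTV⟩,
    h.deriv.boundedTV⟩

theorem HasUniformBounds.conv (h : HasUniformBounds ε p T) (g : 𝓢(ℝ, ℂ)) :
    HasUniformBounds ε p fun x => conv g (T x) where
  uniformRep := h.uniformRep.conv g
  derivParam := by
    obtain ⟨Dl, Dr, hderiv, heq, hl, hr⟩ := h.derivParam
    exact ⟨_, _, fun x hx => ⟨fun φ => (hderiv x hx).1 _, fun φ => (hderiv x hx).2 _⟩,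
      fun x hx hx' => congrArg _ (heq x hx hx'), hl.conv g, hr.conv g⟩
  deriv := by
    simp_rw [derivCLM_conv]
    exact h.uniformRep.conv _

theorem neg_notMem_range_intCast {x : ℝ} (hx : x ∉ Set.range ((↑) : ℤ → ℝ)) :
    -x ∉ Set.range ((↑) : ℤ → ℝ) := by
  rintro ⟨n, hn⟩
  exact hx ⟨-n, by rw [Int.cast_neg, hn, neg_neg]⟩

theorem HasParamDerivWithin.comp_neg {D : 𝓢'(ℝ, ℂ)} {s t : Set ℝ} {x : ℝ}
    (h : HasParamDerivWithin T D s (-x)) (hst : Set.MapsTo Neg.neg t s) :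
    HasParamDerivWithin (fun y => T (-y)) (-D) t x := fun φ => by
  refine ((h φ).scomp x (hasDerivWithinAt_neg x t) hst).congr_deriv ?_
  rw [neg_one_smul]
  rfl

theorem HasUniformBounds.comp_neg (h : HasUniformBounds ε p T) :
    HasUniformBounds (-ε) p fun x => T (-x) where
  uniformRep := h.uniformRep.comp_neg
  derivParam := by
    obtain ⟨Dl, Dr, hderiv, heq, hl, hr⟩ := h.derivParam
    have hsign {x : ℝ} (hx : 0 ≤ -ε * x) : 0 ≤ ε * -x := by rwa [mul_neg, ← neg_mul]
    exact ⟨fun x => -Dr (-x), fun x => -Dl (-x), fun x hx =>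
      ⟨(hderiv _ (hsign hx)).2.comp_neg fun _ hy => by simpa using hy,
        (hderiv _ (hsign hx)).1.comp_neg fun _ hy => by simpa using hy⟩,
      fun x hx hx' => congrArg _ (heq _ (hsign hx) (neg_notMem_range_intCast hx')).symm,
      hr.comp_neg.neg, hl.comp_neg.neg⟩
  deriv := h.deriv.comp_neg

variable {α : ℤ → ℝ}

theorem uniformRep_scatteringDistribution (h : WeightSummable α 1)
    (hp : WeightSummable α (p + 1)) : UniformRep 1 p (scatteringDistribution h) :=
  ⟨(majorant α p 0 - 1).toNNReal, fun x hx => ⟨scatteringMeasure α x, inferInstance,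
    (mass_scatteringMeasure_le hp x).trans (ENNReal.ofReal_le_ofReal
      (sub_le_sub_right (majorant_anti hp (by rwa [one_mul] at hx)) 1)), fun _ => rfl⟩⟩

theorem uniformRep_shiftDistribution (h : WeightSummable α 1) (hp : WeightSummable α (p + 1))
    (c : ℝ) {N : ℝ → ℤ} {t : ℝ → ℤ → ℝ} (hN : ∀ x, x ≤ N x)
    (ht : ∀ (x : ℝ) (n : ℤ), 0 ≤ x → x ≤ n → |t x n| ≤ |(n : ℝ)|) :
    UniformRep 1 p fun x => shiftDistribution h (N x) c (t x) := by
  refine ⟨(|c| * majorant α p 0 * ∑' n : ℤ, |α n| * (1 + |(n : ℝ)|) ^ p).toNNReal,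
    fun x hx => ⟨shiftSum α (N x) c (t x), inferInstance,
      (mass_shiftSum_le hp c fun n hn => ?_).trans (ENNReal.ofReal_le_ofReal ?_), fun _ => rfl⟩⟩
  · rw [one_mul] at hx
    have hxn : x ≤ n := (hN x).trans (by exact_mod_cast hn)
    exact pow_le_pow_left₀ (by positivity) (add_le_add_right (ht x n hx hxn) 1) p
  · rw [one_mul] at hx
    gcongr
    exact majorant_anti hp (hx.trans (hN x))

theorem abs_sub_div_pi_le {x y : ℝ} (hx : 0 ≤ x) (hxy : x ≤ y) : |(y - x) / Real.pi| ≤ |y| := by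
  have hpi : 1 ≤ Real.pi := by linarith [Real.pi_gt_three]
  rw [abs_of_nonneg (div_nonneg (sub_nonneg.2 hxy) (by linarith)), abs_of_nonneg (hx.trans hxy)]
  exact (div_le_self (sub_nonneg.2 hxy) hpi).trans (sub_le_self y hx)

theorem hasUniformBounds_scatteringDistribution (h : WeightSummable α 1)
    (hp : WeightSummable α (p + 1)) : HasUniformBounds 1 p (scatteringDistribution h) where
  uniformRep := uniformRep_scatteringDistribution h hp
  derivParam := by
    refine ⟨fun x => shiftDistribution h ⌈x⌉ (-1) fun n => (n - x) / Real.pi,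
      fun x => shiftDistribution h (⌊x⌋ + 1) (-1) fun n => (n - x) / Real.pi, fun x _ =>
      ⟨hasParamDerivWithin_Iic h (mem_Ioc_ceil x), hasParamDerivWithin_Ici h
        (mem_Ico_floor_add_one x)⟩, fun x _ hx => ?_,
      uniformRep_shiftDistribution h hp _ Int.le_ceil fun _ _ => abs_sub_div_pi_le,
      uniformRep_shiftDistribution h hp _ (fun x => (mem_Ico_floor_add_one x).2.le)
        fun _ _ => abs_sub_div_pi_le⟩
    dsimp only
    rw [(Int.ceil_eq_floor_add_one_iff_notMem x).2 hx]
  deriv := by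
    simp_rw [fun x => derivCLM_scatteringDistribution h (Set.Ioc_subset_Icc_self (mem_Ioc_ceil x))]
    exact (uniformRep_shiftDistribution h hp _ Int.le_ceil fun _ _ => abs_sub_div_pi_le).add
      (uniformRep_shiftDistribution h hp _ Int.le_ceil fun _ _ _ _ => by simp)

end UniformBounds

section Reflection

variable {α : ℤ → ℝ} {k : ℕ} {z : ℂ} {f : ℝ → ℂ}

theorem WeightSummable.comp_neg (h : WeightSummable α k) :
    WeightSummable (fun n => α (-n)) k := by
  simpa [WeightSummable, Function.comp_def] using (Equiv.neg ℤ).summable_iff.2 h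

theorem deriv_comp_neg_eq (f : ℝ → ℂ) : deriv (fun x => f (-x)) = fun x => -deriv f (-x) :=
  funext fun x => deriv_comp_neg f x

theorem IsJostSolution.comp_neg {ε : ℝ} (h : IsJostSolution α ε z f) :
    IsJostSolution (fun n => α (-n)) (-ε) z fun x => f (-x) where
  continuous := h.continuous.comp continuous_neg
  differentiableAt x hx :=
    (h.differentiableAt _ (neg_notMem_range_intCast hx)).comp x differentiableAt_id.neg
  equation x hx := by
    rw [deriv_comp_neg_eq]
    have hcomp := (h.equation (-x) (neg_notMem_range_intCast hx)).scomp x (hasDerivAt_neg x)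
    exact hcomp.neg.congr_deriv (by simp)
  jump n := by
    obtain ⟨dl, dr, hl, hr, hjump⟩ := h.jump (-n)
    push_cast at hl hr hjump
    rw [deriv_comp_neg_eq]
    exact ⟨-dr, -dl, (hr.comp tendsto_neg_nhdsLT).neg, (hl.comp tendsto_neg_nhdsGT).neg,
      by rw [← hjump]; ring⟩
  asymptotic := by
    have hneg : Tendsto (fun x : ℝ => -x) (comap (fun x : ℝ => -ε * x) atTop)
        (comap (fun x : ℝ => ε * x) atTop) :=
      tendsto_comap_iff.2 (tendsto_comap.congr fun x => by simp)
    exact (h.asymptotic.comp_tendsto hneg).congr_right (Eventually.of_forall fun x => by simp)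

theorem isJostSolution_neg_iff :
    IsJostSolution α (-1) z f ↔ IsJostSolution (fun n => α (-n)) 1 z fun x => f (-x) :=
  ⟨fun h => by simpa using h.comp_neg, fun h => by simpa using h.comp_neg⟩

theorem existsUnique_isJostSolution_neg (h : WeightSummable α 1) (l : ℝ) :
    ∃! f, IsJostSolution α (-1) l f := by
  obtain ⟨f, hf, hunique⟩ := existsUnique_isJostSolution h.comp_neg l
  refine ⟨fun x => f (-x), isJostSolution_neg_iff.2 (by simpa using hf), fun g hg => ?_⟩
  ext x
  simp [← hunique _ (isJostSolution_neg_iff.1 hg)]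

theorem mJost_neg_eq (h : WeightSummable α 1) (l x : ℝ) :
    mJost α (-1) l x = mJost (fun n => α (-n)) 1 l (-x) := by
  have hf : IsJostSolution α (-1) l (jost α (-1) l) :=
    Classical.epsilon_spec (existsUnique_isJostSolution_neg h l).exists
  have hg : IsJostSolution (fun n => α (-n)) 1 l (jost (fun n => α (-n)) 1 l) :=
    Classical.epsilon_spec (existsUnique_isJostSolution h.comp_neg l).exists
  rw [mJost, mJost, ← (isJostSolution_neg_iff.1 hf).unique hg]
  simp

end Reflection

section Main

variable {α : ℤ → ℝ} {ε : ℝ} {p : ℕ}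

theorem weightSummable_of_memWeightedL1 {j : ℕ} (hj : 1 ≤ j) (h : MemWeightedL1 (j : ℝ) α) :
    WeightSummable α j := by
  have hpow : Summable fun n : ℤ => |(n : ℝ)| ^ j * |α n| := by
    simpa only [MemWeightedL1, Real.rpow_natCast] using h
  have hzero : Summable fun n : ℤ => if n = 0 then |α 0| else 0 := (hasSum_ite_eq 0 _).summable
  refine ((hpow.mul_left (2 ^ j)).add hzero).of_nonneg_of_le (fun n => by positivity) fun n => ?_
  rcases eq_or_ne n 0 with rfl | hn
  · simp [(Nat.one_le_iff_ne_zero.1 hj)]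
  · have hone : (1 : ℝ) ≤ |(n : ℝ)| := by exact_mod_cast Int.one_le_abs hn
    rw [if_neg hn, add_zero]
    calc |α n| * (1 + |(n : ℝ)|) ^ j ≤ |α n| * (2 * |(n : ℝ)|) ^ j := by gcongr; linarith
      _ = 2 ^ j * (|(n : ℝ)| ^ j * |α n|) := by rw [mul_pow]; ring

theorem existsUnique_isJostSolution_of_sign (h : WeightSummable α 1) (hε : ε = 1 ∨ ε = -1)
    (l : ℝ) : ∃! f, IsJostSolution α ε l f := by
  rcases hε with rfl | rfl
  · exact existsUnique_isJostSolution h l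
  · exact existsUnique_isJostSolution_neg h l

theorem isGivenBy_fourierInv_scatteringDistribution (h : WeightSummable α 1) (x : ℝ) :
    IsGivenBy (𝓕⁻ (scatteringDistribution h x)) fun l => mJost α 1 l x - 1 := by
  simp_rw [mJost_eq_mFun h, mFun_eq h, add_sub_cancel_left]
  exact isGivenBy_fourierInv_toDistribution _

theorem exists_isGivenBy_mJost_sub_one (h : WeightSummable α 1) (hp : WeightSummable α (p + 1))
    (hε : ε = 1 ∨ ε = -1) :
    ∃ U : ℝ → 𝓢'(ℝ, ℂ), (∀ x : ℝ, IsGivenBy (U x) fun l : ℝ => mJost α ε l x - 1) ∧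
      HasUniformBounds ε p fun x => 𝓕 (U x) := by
  rcases hε with rfl | rfl
  · refine ⟨_, isGivenBy_fourierInv_scatteringDistribution h, ?_⟩
    simpa only [fourier_fourierInv_eq] using hasUniformBounds_scatteringDistribution h hp
  · refine ⟨fun x => 𝓕⁻ (scatteringDistribution h.comp_neg (-x)), fun x => ?_, ?_⟩
    · simpa only [mJost_neg_eq h] using isGivenBy_fourierInv_scatteringDistribution h.comp_neg (-x)
    · simpa only [fourier_fourierInv_eq] using
        (hasUniformBounds_scatteringDistribution h.comp_neg hp.comp_neg).comp_neg

end Main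

end DeltaArray

theorem lemma5p5_general (j : ℕ) (hj : 1 ≤ j) (α : ℤ → ℝ)
    (hα : DeltaArray.MemWeightedL1 (j : ℝ) α) (ε : ℝ) (hε : ε = 1 ∨ ε = -1) :
    (∀ l : ℝ, ∃! f : ℝ → ℂ, DeltaArray.IsJostSolution α ε (l : ℂ) f) ∧
    ∃ U : ℝ → 𝓢'(ℝ, ℂ),
      (∀ x : ℝ, DeltaArray.IsGivenBy (U x) fun l : ℝ => DeltaArray.mJost α ε (l : ℂ) x - 1) ∧
      DeltaArray.BoundedTV ε (j - 1) (fun x => 𝓕 (U x)) ∧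
      DeltaArray.BoundedTVDerivParam ε (j - 1) (fun x => 𝓕 (U x)) ∧
      DeltaArray.BoundedTVDeriv ε (j - 1) (fun x => 𝓕 (U x)) ∧
      ∀ g : 𝓢(ℝ, ℂ),
        DeltaArray.BoundedTV ε (j - 1) (fun x => DeltaArray.conv g (𝓕 (U x))) ∧
        DeltaArray.BoundedTVDerivParam ε (j - 1) (fun x => DeltaArray.conv g (𝓕 (U x))) ∧
        DeltaArray.BoundedTVDeriv ε (j - 1) (fun x => DeltaArray.conv g (𝓕 (U x))) := by
  have hweight := DeltaArray.weightSummable_of_memWeightedL1 hj hα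
  have hsum : DeltaArray.WeightSummable α 1 := hweight.mono hj
  rw [← Nat.sub_add_cancel hj] at hweight
  obtain ⟨U, hU, hbounds⟩ := DeltaArray.exists_isGivenBy_mJost_sub_one hsum hweight hε
  obtain ⟨hT, hparam, hderiv⟩ := hbounds.bounded
  exact ⟨DeltaArray.existsUnique_isJostSolution_of_sign hsum hε, U, hU, hT, hparam, hderiv,
    fun g => (hbounds.conv g).bounded⟩

theorem lemma5p5 (j : ℕ) (hj : j = 1 ∨ j = 2) (α : ℤ → ℝ)
    (hα : DeltaArray.MemWeightedL1 (j : ℝ) α) (ε : ℝ) (hε : ε = 1 ∨ ε = -1) :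
    (∀ l : ℝ, ∃! f : ℝ → ℂ, DeltaArray.IsJostSolution α ε (l : ℂ) f) ∧
    ∃ U : ℝ → 𝓢'(ℝ, ℂ),
      (∀ x : ℝ, DeltaArray.IsGivenBy (U x) fun l : ℝ => DeltaArray.mJost α ε (l : ℂ) x - 1) ∧
      DeltaArray.BoundedTV ε (j - 1) (fun x => 𝓕 (U x)) ∧
      DeltaArray.BoundedTVDerivParam ε (j - 1) (fun x => 𝓕 (U x)) ∧
      DeltaArray.BoundedTVDeriv ε (j - 1) (fun x => 𝓕 (U x)) ∧
      ∀ (χ : ℝ → ℂ) (hχc : HasCompactSupport χ) (hχ : ContDiff ℝ ∞ χ),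
        DeltaArray.BoundedTV ε (j - 1)
          (fun x => DeltaArray.conv (𝓕 (hχc.toSchwartzMap hχ)) (𝓕 (U x))) ∧
        DeltaArray.BoundedTVDerivParam ε (j - 1)
          (fun x => DeltaArray.conv (𝓕 (hχc.toSchwartzMap hχ)) (𝓕 (U x))) ∧
        DeltaArray.BoundedTVDeriv ε (j - 1)
          (fun x => DeltaArray.conv (𝓕 (hχc.toSchwartzMap hχ)) (𝓕 (U x))) := by
  obtain ⟨hunique, U, hU, hT, hparam, hderiv, hconv⟩ := lemma5p5_general j (by omega) α hα ε hε
  exact ⟨hunique, U, hU, hT, hparam, hderiv, fun χ hχc hχ => hconv _⟩
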